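/- A one-way nondeterministic $k$-counter machine reads its input $w$, followed by a right end-marker, from left to right (in each step the head stays or moves right); depending on the state, the scanned symbol and which counters are zero, it changes state and changes each of its $k$ non-negative integer counters by $-1$, $0$ or $+1$ (a zero counter is never decremented). All counters start at $0$; $w$ is accepted if some computation reaches an accepting state with exactly $w$ consumed. The machine is $l$-reversal-bounded if in every accepting computation every counter alternates between increasing and decreasing at most $l$ times, and deterministic if its transition relation is a partial function. Let $\mathrm{NCM}(k,l)$ (respectively $\mathrm{DCM}(k,l)$) be the class of $l$-reversal-bounded nondeterministic (respectively deterministic) $k$-counter machines, and also the family of languages they accept. For a language $L$ let $\mathrm{outf}(L)=\{xy \mid xwy\in L \text{ for some word } w\}$. For an alphabet $\Sigma$ and a marker $\$\notin\Sigma$, a language $L\subseteq(\Sigma\cup\{\$\})^*$ is outfix-marked-dense if $\$\Sigma^*\$\subseteq \mathrm{outf}(L)$. **Proposition.** It is undecidable, given $L\in\mathrm{NCM}(1,1)$, whether $L$ is outfix-marked-dense. The same holds for $L\in\mathrm{DCM}(2,1)$ and for $L\in\mathrm{DCM}(1,3)$. More precisely, there is a finite alphabet $\Sigma$ such that for each of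 these three classes no algorithm, given the description of a machine of the class with input alphabet $\Sigma\cup\{\$\}$, always halts and correctly answers whether the language it accepts is outfix-marked-dense. -/

import Mathlib

/-- The outfix operation: `outf L = {xy ∣ xwy ∈ L}`. -/
def outf {A : Type} (L : Language A) : Language A :=
  {z | ∃ x w y : List A, x ++ w ++ y ∈ L ∧ z = x ++ y}

/-- The alphabet `Σ ∪ {$}` with a marker `$ ∉ Σ` adjoined. -/
abbrev WithMarker (σ : Type) : Type := Option σ

/-- The marker `$`. -/
abbrev marker {σ : Type} : WithMarker σ := none

/-- `L ⊆ (Σ ∪ {$})*` is `ϱ`-marked-dense if `$ Σ* $ ⊆ ϱ(L)`. -/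
def MarkedDense {σ : Type} (ϱ : Language (WithMarker σ) → Language (WithMarker σ))
    (L : Language (WithMarker σ)) : Prop :=
  ∀ u : List σ, [marker] ++ u.map some ++ [marker] ∈ ϱ L

/-- The alphabet `A ∪ {◁}` with the right input end-marker `◁ ∉ A` adjoined. -/
abbrev WithEnd (A : Type) : Type := Option A

/-- The end-marker `◁`. -/
abbrev endMarker {A : Type} : WithEnd A := none

/-- A transition `(q, a, c₁, …, c_k) ↦ (p, d, d₁, …, d_k)` of a `k`-counter machine: the state `q`,
the scanned symbol `a`, the test `c_i` of each counter (`true` for positive, `false` for zero);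
then the new state `p`, the head move `d` (`true` for right, `false` for stay), and the change
`d_i ∈ {-1, 0, +1}` of each counter. -/
abbrev Transition (k : ℕ) (A : Type) : Type :=
  (ℕ × WithEnd A × (Fin k → Bool)) × (ℕ × Bool × (Fin k → SignType))

/-- A one-way nondeterministic `k`-counter machine over the input alphabet `A`. The states are
`0, …, numStates - 1`; the finite set of accepting states and the finite transition relation are
given by lists of their elements. -/
structure CounterMachine (k : ℕ) (A : Type) where
  numStates : ℕ
  start : ℕ
  accept : List ℕ
  trans : List (Transition k A)
  start_lt : start < numStates
  accept_lt : ∀ q ∈ accept, q < numStates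
  trans_lt : ∀ t ∈ trans, t.1.1 < numStates ∧ t.2.1 < numStates
  /-- a counter that is zero is never decremented -/
  trans_nonneg : ∀ t ∈ trans, ∀ i, t.1.2.2 i = false → 0 ≤ t.2.2.2 i

namespace CounterMachine

variable {k : ℕ} {A : Type}

/-- A configuration: state, input still to be read (including the end-marker), counters. -/
structure Config (k : ℕ) (A : Type) where
  state : ℕ
  input : List (WithEnd A)
  counter : Fin k → ℕ

/-- `M.Step c d c'`: one step from `c` to `c'`, changing the counters by `d`. -/
def Step (M : CounterMachine k A) (c : Config k A) (d : Fin k → SignType) (c' : Config k A) :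
    Prop :=
  ∃ (a : WithEnd A) (rest : List (WithEnd A)) (right : Bool),
    c.input = a :: rest ∧
    ((c.state, a, fun i => decide (0 < c.counter i)), (c'.state, right, d)) ∈ M.trans ∧
    c'.input = (if right then rest else a :: rest) ∧
    ∀ i, (c'.counter i : ℤ) = (c.counter i : ℤ) + (d i : ℤ)

/-- `M.Run c ds c'`: a computation from `c` to `c'`; `ds` is the sequence of counter changes. -/
inductive Run (M : CounterMachine k A) :
    Config k A → List (Fin k → SignType) → Config k A → Prop
  | nil (c : Config k A) : Run M c [] c
  | cons {c c' c'' : Config k A} {d : Fin k → SignType} {ds : List (Fin k → SignType)} :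
      M.Step c d c' → Run M c' ds c'' → Run M c (d :: ds) c''

/-- The initial configuration `(q₀, w◁, 0, …, 0)`. -/
def init (M : CounterMachine k A) (w : List A) : Config k A where
  state := M.start
  input := w.map some ++ [endMarker]
  counter := fun _ => 0

/-- `ds` is the sequence of counter changes of an accepting computation of `M` on `w`, which leads
from the initial configuration to some `(q, ◁, c₁, …, c_k)` with `q` accepting. -/
def AcceptingRun (M : CounterMachine k A) (w : List A) (ds : List (Fin k → SignType)) : Prop :=
  ∃ c : Config k A, M.Run (M.init w) ds c ∧ c.state ∈ M.accept ∧ c.input = [endMarker]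

/-- The language accepted by `M`. -/
def language (M : CounterMachine k A) : Language A :=
  {w | ∃ ds, M.AcceptingRun w ds}

/-- `M` is deterministic if its transition relation is a partial function. -/
def Deterministic (M : CounterMachine k A) : Prop :=
  ∀ t ∈ M.trans, ∀ t' ∈ M.trans, t.1 = t'.1 → t.2 = t'.2

/-- The number of alternations between increasing and decreasing in a sequence of changes of one
counter: drop the zeros, merge equal neighbours, and count the remaining places where the sign
changes. -/
def reversals (ds : List SignType) : ℕ :=
  ((ds.filter (· ≠ 0)).destutter (· ≠ ·)).length - 1

/-- `M` is `l`-reversal-bounded: in every accepting computation, every counter alternates between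
increasing and decreasing at most `l` times. -/
def ReversalBounded (M : CounterMachine k A) (l : ℕ) : Prop :=
  ∀ w ds, M.AcceptingRun w ds → ∀ i, reversals (ds.map (· i)) ≤ l

/-- What is handed to an algorithm when `M` is given: the complete finite description of `M`. -/
def code (M : CounterMachine k A) : ℕ × ℕ × List ℕ × List (Transition k A) :=
  (M.numStates, M.start, M.accept, M.trans)

/-- A machine can be recovered from its description. -/
theorem code_injective : Function.Injective (code : CounterMachine k A → _) := by
  intro M N h
  cases M
  cases N
  simp_all [code]

end CounterMachine

/-- The `l`-reversal-bounded nondeterministic `k`-counter machines over `A`. -/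
def NCM (k l : ℕ) (A : Type) : Set (CounterMachine k A) :=
  {M | M.ReversalBounded l}

/-- The `l`-reversal-bounded deterministic `k`-counter machines over `A`. -/
def DCM (k l : ℕ) (A : Type) : Set (CounterMachine k A) :=
  {M | M.Deterministic ∧ M.ReversalBounded l}

/-- The three signs form an effectively coded (finite) type. -/
instance : Primcodable SignType :=
  Primcodable.ofEquiv (Fin 3) SignType.fin3Equiv.toEquiv

/-- The property `P` is decidable for machines given from the class `C`: some algorithm halts with
the correct answer on the description of each machine in `C`. Nothing is required of the algorithm
on other inputs. -/
def DecidableFor {k : ℕ} {A : Type} [Primcodable A] (C : Set (CounterMachine k A))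
    (P : CounterMachine k A → Prop) : Prop :=
  ∃ f : (ℕ × ℕ × List ℕ × List (Transition k A)) →. Bool, Partrec f ∧
    ∀ M ∈ C, ∃ b ∈ f M.code, (b = true ↔ P M)

/-! The halting problem is reduced to the failure of density. A register program is treated as a
regular language of words of instructions (increment, decrement, zero test); a word matters only if
all its decrements and tests succeed. Sequencing is concatenation and a loop is a star followed by a
test. Induction over the partial recursive functions (`Computes`) then gives, for each such `f`, an
automaton `D` such that `f n` is defined iff some word accepted by `D` is executable with `n` in
register 0 and the other registers empty (`exists_dfa_of_partrec`).

A history is a word `u` of instructions separated by blocks of units that note the register contents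
in between. By `exists_right_iff`, `f n` is defined iff some history has no error, an error being a
wrong first block, an instruction word rejected by `D`, or one instruction that is wrong for one
register. The last kind compares two neighbouring blocks and needs one counter: up along the first,
adjusted by the instruction, down along the second.

The language attached to `n` consists of the words `w $ u $` in which `w` describes an error of `u`.
Deleting `w` acts as an existential quantifier, so `$ u $` is an outfix iff `u` has some error, and
density says that no history is free of errors (`exists_accepts_start`, `markedDense_outf_iff`). The
place of the error can be guessed, with one counter and one reversal. A deterministic machine reads
it off the length of `w`, emptying that counter before the comparison starts: this costs a second
counter with one reversal, or two further reversals of the same counter. With `f` universal only `n`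
varies, and the machine is described primitively recursively in `n` (`primrec_code_machine`). -/

/-! ### Regular languages: products, stars and single letters -/

namespace Language

variable {α : Type*}

/-- A factorisation of `x ++ y` is cut either inside `y`, leaving a quotient of `L` by `x`, or
inside `x`, leaving a quotient of `M` by a suffix of `x`. So the result depends only on one quotient
of `L` and a set of quotients of `M`, of which there are finitely many in the regular case. -/
theorem leftQuotient_mul (L M : Language α) (x : List α) :
    (L * M).leftQuotient x = {y | y ∈ L.leftQuotient x * M ∨
      ∃ N ∈ {N | ∃ u v, x = u ++ v ∧ u ∈ L ∧ N = M.leftQuotient v}, y ∈ N} := by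
  apply Set.ext
  intro y
  change x ++ y ∈ L * M ↔ _
  simp only [mem_mul, Set.mem_ofPred_eq, mem_leftQuotient]
  constructor
  · rintro ⟨a, ha, b, hb, h⟩
    rcases List.append_eq_append_iff.1 h with ⟨c, rfl, rfl⟩ | ⟨c, rfl, rfl⟩
    · exact Or.inr ⟨_, ⟨a, c, rfl, ha, rfl⟩, hb⟩
    · exact Or.inl ⟨c, ha, b, hb, rfl⟩
  · rintro (⟨c, ha, b, hb, rfl⟩ | ⟨_, ⟨a, c, rfl, ha, rfl⟩, hb⟩)
    · exact ⟨_, ha, b, hb, by simp⟩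
    · exact ⟨_, ha, _, hb, by simp⟩

theorem IsRegular.mul {L M : Language α} (hL : L.IsRegular) (hM : M.IsRegular) :
    (L * M).IsRegular := by
  apply IsRegular.of_finite_range_leftQuotient
  refine ((hL.finite_range_leftQuotient.prod hM.finite_range_leftQuotient.powerset).image
    (fun p : Language α × Set (Language α) =>
      ({y | y ∈ p.1 * M ∨ ∃ N ∈ p.2, y ∈ N} : Language α))).subset ?_
  rintro _ ⟨x, rfl⟩
  refine ⟨(L.leftQuotient x, {N | ∃ u v, x = u ++ v ∧ u ∈ L ∧ N = M.leftQuotient v}),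
    ⟨⟨x, rfl⟩, ?_⟩, (leftQuotient_mul L M x).symm⟩
  rintro _ ⟨u, v, -, -, rfl⟩
  exact ⟨v, rfl⟩

theorem append_mem_kstar {L : Language α} {x y : List α} (hx : x ∈ KStar.kstar L)
    (hy : y ∈ KStar.kstar L) : x ++ y ∈ KStar.kstar L := by
  obtain ⟨S, rfl, hS⟩ := mem_kstar.1 hx
  obtain ⟨T, rfl, hT⟩ := mem_kstar.1 hy
  refine mem_kstar.2 ⟨S ++ T, by simp, fun z hz => ?_⟩
  rcases List.mem_append.1 hz with h | h
  exacts [hS z h, hT z h]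

theorem mem_kstar_of_mem {L : Language α} {x : List α} (hx : x ∈ L) : x ∈ KStar.kstar L :=
  mem_kstar.2 ⟨[x], by simp, by simpa using hx⟩

/-- The block in which `x` ends has its beginning `v` in `x`, and the blocks before it form `u`. The
empty concatenation has no such block, hence the separate case. -/
theorem exists_split_of_append_mem_kstar {L : Language α} (S : List (List α))
    (hS : ∀ z ∈ S, z ∈ L) (x y : List α) (h : x ++ y = S.flatten) :
    (x = [] ∧ y = []) ∨ ∃ u v, x = u ++ v ∧ u ∈ KStar.kstar L ∧
      y ∈ L.leftQuotient v * KStar.kstar L := by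
  induction S generalizing x with
  | nil => left; simpa using h
  | cons a S ih =>
    have ha : a ∈ L := hS a (by simp)
    have hS' : ∀ z ∈ S, z ∈ L := fun z hz => hS z (by simp [hz])
    have h' : x ++ y = a ++ S.flatten := by simpa using h
    rcases List.append_eq_append_iff.1 h' with ⟨c, rfl, rfl⟩ | ⟨c, rfl, hc⟩
    · exact Or.inr ⟨[], x, rfl, nil_mem_kstar L, mem_mul.2
        ⟨c, ha, S.flatten, mem_kstar.2 ⟨S, rfl, hS'⟩, rfl⟩⟩
    · right
      rcases ih hS' c hc.symm with ⟨rfl, rfl⟩ | ⟨u, v, rfl, hu, hy⟩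
      · exact ⟨[], a ++ [], rfl, nil_mem_kstar L, mem_mul.2
          ⟨[], by simpa using ha, [], nil_mem_kstar L, rfl⟩⟩
      · exact ⟨a ++ u, v, by simp, append_mem_kstar (mem_kstar_of_mem ha) hu, hy⟩

theorem leftQuotient_kstar (L : Language α) (x : List α) :
    (KStar.kstar L).leftQuotient x = {y | (x = [] ∧ y = []) ∨
      ∃ N ∈ {N | ∃ u v, x = u ++ v ∧ u ∈ KStar.kstar L ∧ N = L.leftQuotient v},
        y ∈ N * KStar.kstar L} := by
  apply Set.ext
  intro y
  change x ++ y ∈ KStar.kstar L ↔ _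
  constructor
  · intro h
    obtain ⟨S, h, hS⟩ := mem_kstar.1 h
    rcases exists_split_of_append_mem_kstar S hS x y h with h | ⟨u, v, rfl, hu, hy⟩
    · exact Or.inl h
    · exact Or.inr ⟨_, ⟨u, v, rfl, hu, rfl⟩, hy⟩
  · rintro (⟨rfl, rfl⟩ | ⟨_, ⟨u, v, rfl, hu, rfl⟩, hy⟩)
    · exact nil_mem_kstar L
    · obtain ⟨c, hc, d, hd, rfl⟩ := mem_mul.1 hy
      have := append_mem_kstar hu (append_mem_kstar (mem_kstar_of_mem hc) hd)
      simpa using this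

theorem IsRegular.kstar {L : Language α} (hL : L.IsRegular) : (KStar.kstar L).IsRegular := by
  apply IsRegular.of_finite_range_leftQuotient
  -- The component in `Prop` records whether `x` is empty.
  refine (((Set.toFinite (Set.univ : Set Prop)).prod hL.finite_range_leftQuotient.powerset).image
    (fun p : Prop × Set (Language α) =>
      ({y | (p.1 ∧ y = []) ∨ ∃ N ∈ p.2, y ∈ N * KStar.kstar L} : Language α))).subset ?_
  rintro _ ⟨x, rfl⟩
  refine ⟨(x = [], {N | ∃ u v, x = u ++ v ∧ u ∈ KStar.kstar L ∧ N = L.leftQuotient v}),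
    ⟨trivial, ?_⟩, (leftQuotient_kstar L x).symm⟩
  rintro _ ⟨u, v, -, -, rfl⟩
  exact ⟨v, rfl⟩

theorem isRegular_singleton (a : α) : ({[a]} : Language α).IsRegular := by
  apply IsRegular.of_finite_range_leftQuotient
  refine (Set.toFinite ({{[a]}, 1, 0} : Set (Language α))).subset ?_
  rintro _ ⟨x, rfl⟩
  rcases x with _ | ⟨b, _ | ⟨c, x⟩⟩
  · left; rfl
  · by_cases h : b = a
    · right; left
      apply Set.ext
      intro y
      change [b] ++ y = [a] ↔ y = []
      simp [h]
    · right; right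
      apply Set.ext
      intro y
      change [b] ++ y = [a] ↔ False
      simp [h]
  · right; right
    apply Set.ext
    intro y
    change (b :: c :: x) ++ y = [a] ↔ False
    simp

end Language

/-! ### Instructions on registers and their execution -/

/-- An instruction `(r, d)` on a register `r`: increment for `d = 1`, decrement for `d = -1` and
zero test for `d = 0`. -/
abbrev Instruction (ρ : Type) : Type := ρ × SignType

namespace Instruction

variable {ρ : Type} [DecidableEq ρ]

/-- `i.Effect r m m'`: the instruction `i` may change the content of register `r` from `m` to
`m'`. -/
def Effect (i : Instruction ρ) (r : ρ) (m m' : ℕ) : Prop :=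
  if i.1 = r then
    (i.2 = 1 ∧ m' = m + 1) ∨ (i.2 = -1 ∧ m = m' + 1) ∨ (i.2 = 0 ∧ m = 0 ∧ m' = 0)
  else m' = m

/-- `Exec w s s'`: the sequence of instructions `w` can be executed from the register contents `s`
and leads to `s'`. -/
def Exec : List (Instruction ρ) → (ρ → ℕ) → (ρ → ℕ) → Prop
  | [], s, s' => s' = s
  | i :: w, s, s' => ∃ t, (∀ r, Effect i r (s r) (t r)) ∧ Exec w t s'

theorem exec_append {v w : List (Instruction ρ)} {s s' : ρ → ℕ} :
    Exec (v ++ w) s s' ↔ ∃ t, Exec v s t ∧ Exec w t s' := by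
  induction v generalizing s with
  | nil => simp [Exec]
  | cons i v ih =>
    simp only [List.cons_append, Exec, ih]
    exact ⟨fun ⟨t, ht, u, hu, hw⟩ => ⟨u, ⟨t, ht, hu⟩, hw⟩,
      fun ⟨u, ⟨t, ht, hu⟩, hw⟩ => ⟨t, ht, u, hu, hw⟩⟩

end Instruction

/-! ### Regular relations between register contents -/

namespace RegisterTrace

open Instruction Function

/-- Register contents. -/
abbrev Regs : Type := ℕ → ℕ

/-- A relation between register contents is regular if it is effected by the words of a regular
language of instructions on finitely many registers. -/
def RegularRel (R : Regs → Regs → Prop) : Prop :=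
  ∃ L : Language (Instruction ℕ), L.IsRegular ∧ (∃ K, ∀ w ∈ L, ∀ i ∈ w, i.1 < K) ∧
    ∀ s s', R s s' ↔ ∃ w ∈ L, Exec w s s'

theorem RegularRel.comp {R S : Regs → Regs → Prop} (hR : RegularRel R) (hS : RegularRel S) :
    RegularRel (Relation.Comp R S) := by
  obtain ⟨L, hL, ⟨K, hK⟩, hR⟩ := hR
  obtain ⟨M, hM, ⟨K', hK'⟩, hS⟩ := hS
  refine ⟨L * M, hL.mul hM, ⟨max K K', ?_⟩, fun s s' => ?_⟩
  · intro w hw i hi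
    obtain ⟨a, ha, b, hb, rfl⟩ := Language.mem_mul.1 hw
    rcases List.mem_append.1 hi with h | h
    · exact lt_max_of_lt_left (hK a ha i h)
    · exact lt_max_of_lt_right (hK' b hb i h)
  · constructor
    · rintro ⟨t, h, h'⟩
      obtain ⟨a, ha, h⟩ := (hR _ _).1 h
      obtain ⟨b, hb, h'⟩ := (hS _ _).1 h'
      exact ⟨a ++ b, Language.mem_mul.2 ⟨a, ha, b, hb, rfl⟩, exec_append.2 ⟨t, h, h'⟩⟩
    · rintro ⟨w, hw, h⟩
      obtain ⟨a, ha, b, hb, rfl⟩ := Language.mem_mul.1 hw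
      obtain ⟨t, h, h'⟩ := exec_append.1 h
      exact ⟨t, (hR _ _).2 ⟨a, ha, h⟩, (hS _ _).2 ⟨b, hb, h'⟩⟩

theorem RegularRel.star {R : Regs → Regs → Prop} (hR : RegularRel R) :
    RegularRel (Relation.ReflTransGen R) := by
  obtain ⟨L, hL, ⟨K, hK⟩, hR⟩ := hR
  refine ⟨KStar.kstar L, hL.kstar, ⟨K, ?_⟩, fun s s' => ?_⟩
  · intro w hw i hi
    obtain ⟨S, rfl, hS⟩ := Language.mem_kstar.1 hw
    obtain ⟨a, ha, hi⟩ := List.mem_flatten.1 hi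
    exact hK a (hS a ha) i hi
  · constructor
    · intro h
      induction h with
      | refl => exact ⟨[], Language.nil_mem_kstar L, rfl⟩
      | tail _ h ih =>
        obtain ⟨w, hw, ih⟩ := ih
        obtain ⟨a, ha, h⟩ := (hR _ _).1 h
        exact ⟨w ++ a, Language.append_mem_kstar hw (Language.mem_kstar_of_mem ha),
          exec_append.2 ⟨_, ih, h⟩⟩
    · rintro ⟨w, hw, h⟩
      obtain ⟨S, rfl, hS⟩ := Language.mem_kstar.1 hw
      clear hw
      induction S generalizing s with
      | nil => rw [show s' = s from h]
      | cons a S ih =>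
        obtain ⟨t, h, h'⟩ := exec_append.1 h
        exact Relation.ReflTransGen.head ((hR _ _).2 ⟨a, hS a (by simp), h⟩)
          (ih _ (fun z hz => hS z (by simp [hz])) h')

theorem regularRel_instruction (i : Instruction ℕ) :
    RegularRel fun s s' => ∀ r, Effect i r (s r) (s' r) := by
  refine ⟨{[i]}, Language.isRegular_singleton i, ⟨i.1 + 1, ?_⟩, fun s s' => ?_⟩
  · intro w hw j hj
    obtain rfl : w = [i] := hw
    obtain rfl : j = i := by simpa using hj
    exact Nat.lt_succ_self _
  · constructor
    · exact fun h => ⟨[i], rfl, s', h, rfl⟩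
    · rintro ⟨w, hw, h⟩
      obtain rfl : w = [i] := hw
      obtain ⟨t, h, rfl⟩ := h
      exact h

theorem RegularRel.of_iff {R S : Regs → Regs → Prop} (hR : RegularRel R)
    (h : ∀ s s', S s s' ↔ R s s') : RegularRel S := by
  rwa [show S = R from funext fun s => funext fun s' => propext (h s s')]

theorem regularRel_inc (r : ℕ) : RegularRel fun s s' => s' = update s r (s r + 1) := by
  refine (regularRel_instruction (r, 1)).of_iff fun s s' => ?_
  constructor
  · rintro rfl x
    by_cases h : r = x
    · subst h; simp [Effect]
    · simp [Effect, h, Ne.symm h]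
  · intro h
    funext x
    have := h x
    by_cases hx : r = x
    · subst hx; simpa [Effect] using this
    · simpa [Effect, hx, Ne.symm hx] using this

theorem regularRel_dec (r : ℕ) :
    RegularRel fun s s' => 0 < s r ∧ s' = update s r (s r - 1) := by
  refine (regularRel_instruction (r, -1)).of_iff fun s s' => ?_
  constructor
  · rintro ⟨h, rfl⟩ x
    by_cases hx : r = x
    · subst hx; simp [Effect]; omega
    · simp [Effect, hx, Ne.symm hx]
  · intro h
    have h0 := h r
    simp [Effect] at h0
    refine ⟨by omega, funext fun x => ?_⟩
    have := h x
    by_cases hx : r = x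
    · subst hx; simp; omega
    · simpa [Effect, hx, Ne.symm hx] using this

theorem regularRel_zero (r : ℕ) : RegularRel fun s s' => s r = 0 ∧ s' = s := by
  refine (regularRel_instruction (r, 0)).of_iff fun s s' => ?_
  constructor
  · rintro ⟨h, rfl⟩ x
    by_cases hx : r = x
    · subst hx; simp [Effect, h]
    · simp [Effect, hx]
  · intro h
    have h0 := h r
    simp [Effect] at h0
    refine ⟨by omega, funext fun x => ?_⟩
    have := h x
    by_cases hx : r = x
    · subst hx; omega
    · simpa [Effect, hx] using this

theorem regularRel_eq : RegularRel fun s s' => s' = s := by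
  refine ⟨1, ?_, ⟨0, ?_⟩, fun s s' => ?_⟩
  · have h : (0 : Language (Instruction ℕ)).IsRegular := by
      refine ⟨Unit, inferInstance, ⟨fun _ _ => (), (), ∅⟩, ?_⟩
      apply Set.ext
      intro y
      change () ∈ (∅ : Set Unit) ↔ False
      simp
    simpa using h.kstar
  · intro w hw
    obtain rfl : w = [] := hw
    simp
  · constructor
    · exact fun h => ⟨[], rfl, h⟩
    · rintro ⟨w, hw, h⟩
      obtain rfl : w = [] := hw
      exact h

/-- The closure of a relation that is a partial function along a sequence. -/
theorem reflTransGen_iff_of_sequence {R : Regs → Regs → Prop} {S : ℕ → Regs} {P : ℕ → Prop}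
    (h : ∀ j, (∀ i < j, P i) → ∀ t, R (S j) t ↔ P j ∧ t = S (j + 1)) (t : Regs) :
    Relation.ReflTransGen R (S 0) t ↔ ∃ j, t = S j ∧ ∀ i < j, P i := by
  constructor
  · intro ht
    induction ht with
    | refl => exact ⟨0, rfl, by simp⟩
    | tail _ ht ih =>
      obtain ⟨j, rfl, hj⟩ := ih
      obtain ⟨hP, rfl⟩ := (h j hj _).1 ht
      exact ⟨j + 1, rfl, fun i hi => (Nat.lt_succ_iff_lt_or_eq.1 hi).elim (hj i) (· ▸ hP)⟩
  · rintro ⟨j, rfl, hj⟩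
    induction j with
    | zero => exact .refl
    | succ j ih =>
      have hj' : ∀ i < j, P i := fun i hi => hj i (by omega)
      exact (ih hj').tail ((h j hj' _).2 ⟨hj j (by omega), rfl⟩)

/-- A loop that counts register `r` down to zero. -/
theorem countdown_iff {R : Regs → Regs → Prop} {S : ℕ → Regs} {r m : ℕ}
    (hr : ∀ j ≤ m, S j r = m - j)
    (h : ∀ j ≤ m, ∀ t, R (S j) t ↔ j < m ∧ t = S (j + 1)) (t : Regs) :
    Relation.Comp (Relation.ReflTransGen R) (fun s s' => s r = 0 ∧ s' = s) (S 0) t ↔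
      t = S m := by
  -- The step hypothesis `h` is available only for `j ≤ m`; this bound follows from the guard having
  -- held at the previous index.
  have key := reflTransGen_iff_of_sequence (R := R) (S := S) (P := fun j => j < m)
    (fun j hj t => h j (by
      rcases j with _ | j
      · omega
      · exact hj j (by omega)) t)
  constructor
  · rintro ⟨u, hu, h0, rfl⟩
    obtain ⟨j, rfl, hj⟩ := (key _).1 hu
    have hjm : j ≤ m := by
      rcases j with _ | j
      · omega
      · exact hj j (by omega)
    rw [hr j hjm] at h0
    rw [show j = m by omega]
  · rintro rfl
    exact ⟨S m, (key _).2 ⟨m, rfl, fun i hi => hi⟩, by rw [hr m le_rfl]; omega, rfl⟩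

theorem regularRel_clear (r : ℕ) : RegularRel fun s s' => s' = update s r 0 := by
  refine ((regularRel_dec r).star.comp (regularRel_zero r)).of_iff fun s s' => ?_
  have := countdown_iff (R := fun s s' => 0 < s r ∧ s' = update s r (s r - 1))
    (S := fun j => update s r (s r - j)) (r := r) (m := s r) (by simp) (by
      intro j hj t
      simp only [update_self, update_idem, Nat.sub_sub]
      exact and_congr_left fun _ => by omega) s'
  simpa using this.symm

theorem regularRel_move {a b : ℕ} (hab : a ≠ b) :
    RegularRel fun s s' => s' = update (update s b (s b + s a)) a 0 := by
  refine (((regularRel_dec a).comp (regularRel_inc b)).star.comp (regularRel_zero a)).of_iff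
    fun s s' => ?_
  have := countdown_iff
    (R := Relation.Comp (fun s s' => 0 < s a ∧ s' = update s a (s a - 1))
      (fun s s' : Regs => s' = update s b (s b + 1)))
    (S := fun j => update (update s b (s b + j)) a (s a - j)) (r := a) (m := s a) (by simp) (by
      intro j hj t
      have : update (update (update s b (s b + j)) a (s a - j - 1)) b (s b + j + 1) =
          update (update s b (s b + (j + 1))) a (s a - (j + 1)) := by
        funext x
        simp only [update_apply]
        split_ifs <;> omega
      constructor
      · rintro ⟨_, ⟨h, rfl⟩, rfl⟩
        simp [hab.symm] at h ⊢
        exact ⟨h, this⟩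
      · rintro ⟨h, rfl⟩
        refine ⟨_, ⟨by simpa using h, rfl⟩, ?_⟩
        simp [hab.symm, this]) s'
  simpa using this.symm

/-- Register `a` is emptied into both `b` and `c`, and `c` is then moved back to `a`. As `c` is
scratch space, the behaviour is specified only where `c` is empty. -/
theorem exists_regularRel_copy {a b c : ℕ} (hab : a ≠ b) (hac : a ≠ c) (hbc : b ≠ c) :
    ∃ R, RegularRel R ∧ ∀ s s', s c = 0 → (R s s' ↔ s' = update s b (s b + s a)) := by
  refine ⟨_, ((((regularRel_dec a).comp (regularRel_inc b)).comp
    (regularRel_inc c)).star.comp (regularRel_zero a)).comp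
    (regularRel_move hac.symm), fun s s' hs => ?_⟩
  have key := countdown_iff
    (R := Relation.Comp (Relation.Comp (fun s s' => 0 < s a ∧ s' = update s a (s a - 1))
      (fun s s' : Regs => s' = update s b (s b + 1)))
      (fun s s' : Regs => s' = update s c (s c + 1)))
    (S := fun j => update (update (update s b (s b + j)) a (s a - j)) c j)
    (r := a) (m := s a) (by simp [hac]) (by
      intro j hj t
      have : update (update (update (update (update (update s b (s b + j)) a (s a - j)) c j) a
          (s a - j - 1)) b (s b + j + 1)) c (j + 1) =
          update (update (update s b (s b + (j + 1))) a (s a - (j + 1))) c (j + 1) := by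
        funext x
        simp only [update_apply]
        split_ifs <;> omega
      constructor
      · rintro ⟨_, ⟨_, ⟨h, rfl⟩, rfl⟩, rfl⟩
        simp [hab.symm, hac, hbc, hac.symm, hbc.symm] at h ⊢
        exact ⟨h, this⟩
      · rintro ⟨h, rfl⟩
        refine ⟨_, ⟨_, ⟨by simpa [hac] using h, rfl⟩, rfl⟩, ?_⟩
        simp [hab.symm, hac, hbc, hac.symm, hbc.symm, this])
  have h0 : update (update (update s b (s b + 0)) a (s a - 0)) c 0 = s := by
    funext x
    simp only [update_apply]
    split_ifs <;> subst_vars <;> omega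
  have hfin : update (update (update (update (update s b (s b + s a)) a (s a - s a)) c (s a)) a
      (s a - s a + s a)) c 0 = update s b (s b + s a) := by
    funext x
    simp only [update_apply]
    split_ifs <;> subst_vars <;> omega
  simp only [h0] at key
  constructor
  · rintro ⟨t, ht, rfl⟩
    rw [(key t).1 ht]
    simpa [hab, hac, hbc, hac.symm, hbc.symm] using hfin
  · rintro rfl
    refine ⟨_, (key _).2 rfl, ?_⟩
    simpa [hab, hac, hbc, hac.symm, hbc.symm] using hfin.symm

end RegisterTrace

/-! ### Partial recursive functions as regular relations -/

namespace RegisterTrace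

open Instruction Function

/-- `f` is computed by regular relations: from input registers `i` below `b`, with all registers
from `b` on empty, the result appears in register `b` and nothing else changes. -/
def Computes {n : ℕ} (f : List.Vector ℕ n →. ℕ) : Prop :=
  ∀ (i : List.Vector ℕ n) (b : ℕ), (∀ r ∈ i.toList, r < b) → ∃ R, RegularRel R ∧
    ∀ s : Regs, (∀ r, b ≤ r → s r = 0) → ∀ s', R s s' ↔ ∃ y ∈ f (i.map s), s' = update s b y

theorem vector_map_congr {n : ℕ} {i : List.Vector ℕ n} {s t : Regs}
    (h : ∀ r ∈ i.toList, s r = t r) : i.map s = i.map t := by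
  apply List.Vector.eq
  simpa using h

theorem mem_mOfFn_iff {α : Type} {n : ℕ} (f : Fin n → Part α) (v : List.Vector α n) :
    v ∈ List.Vector.mOfFn f ↔ ∀ j, v.get j ∈ f j := by
  induction n with
  | zero => simp [List.Vector.mOfFn, List.Vector.eq_nil v]
  | succ n ih =>
    simp only [List.Vector.mOfFn, Part.bind_eq_bind, Part.mem_bind_iff, ih, Part.pure_eq_some,
      Part.mem_some_iff, Fin.forall_fin_succ]
    constructor
    · rintro ⟨a, ha, w, hw, rfl⟩
      simpa using ⟨ha, hw⟩
    · rintro ⟨h0, hs⟩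
      exact ⟨v.head, by simpa using h0, v.tail, by simpa using hs, by simp⟩

theorem regularRel_clear_range (c m : ℕ) :
    RegularRel fun s s' => s' = fun r => if c ≤ r ∧ r < c + m then 0 else s r := by
  induction m with
  | zero =>
    refine regularRel_eq.of_iff fun s s' => ?_
    have : (fun r => if c ≤ r ∧ r < c + 0 then 0 else s r) = s := by
      funext r
      rw [if_neg (by omega)]
    rw [this]
  | succ m ih =>
    refine (ih.comp (regularRel_clear (c + m))).of_iff fun s s' => ?_
    have : update (fun r => if c ≤ r ∧ r < c + m then 0 else s r) (c + m) 0 =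
        fun r => if c ≤ r ∧ r < c + (m + 1) then 0 else s r := by
      funext r
      simp only [update_apply]
      split_ifs <;> omega
    rw [← this]
    exact ⟨fun h => ⟨_, rfl, h⟩, fun ⟨_, h, h'⟩ => h ▸ h'⟩

theorem computes_get {n : ℕ} (j : Fin n) :
    Computes (fun v => Part.some (v.get j) : List.Vector ℕ n →. ℕ) := by
  intro i b hi
  have hj : i.get j < b := hi _ (List.Vector.get_mem _ _)
  obtain ⟨R, hR, h⟩ := exists_regularRel_copy (a := i.get j) (b := b) (c := b + 1)
    (by omega) (by omega) (by omega)
  refine ⟨R, hR, fun s hs s' => ?_⟩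
  rw [h s s' (hs _ (by omega)), hs b le_rfl]
  simp

theorem computes_succ :
    Computes (fun v => Part.some v.head.succ : List.Vector ℕ 1 →. ℕ) := by
  intro i b hi
  obtain ⟨R, hR, h⟩ := computes_get (0 : Fin 1) i b hi
  refine ⟨_, hR.comp (regularRel_inc b), fun s hs s' => ?_⟩
  simp only [Relation.Comp, h s hs]
  simp

theorem computes_zero : Computes (fun _ => Part.some 0 : List.Vector ℕ 0 →. ℕ) := by
  intro i b hi
  refine ⟨_, regularRel_eq, fun s hs s' => ?_⟩
  have : update s b 0 = s := by rw [← hs b le_rfl, update_eq_self]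
  simp [this]

/-- The arguments of an outer function are evaluated one after another into the registers from `b`
on, each using only empty registers above its own output. Values of `y` from `l` on are irrelevant;
a total `y` keeps the induction free of dependent indices. -/
theorem exists_regularRel_comp_args {m n : ℕ} {g : Fin n → List.Vector ℕ m →. ℕ}
    (hg : ∀ j, Computes (g j)) (i : List.Vector ℕ m) (b : ℕ) (hi : ∀ r ∈ i.toList, r < b)
    (l : ℕ) (hl : l ≤ n) : ∃ R, RegularRel R ∧ ∀ s : Regs, (∀ r, b ≤ r → s r = 0) → ∀ s',
      R s s' ↔ ∃ y : ℕ → ℕ, (∀ j : Fin n, j < l → y j ∈ g j (i.map s)) ∧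
        s' = fun r => if b ≤ r ∧ r < b + l then y (r - b) else s r := by
  induction l with
  | zero =>
    refine ⟨_, regularRel_eq, fun s hs s' => ?_⟩
    have : ∀ y : ℕ → ℕ, (fun r => if b ≤ r ∧ r < b + 0 then y (r - b) else s r) = s := by
      intro y
      funext r
      rw [if_neg (by omega)]
    simp only [this]
    simp
  | succ l ih =>
    obtain ⟨R, hR, h⟩ := ih (by omega)
    obtain ⟨R', hR', h'⟩ := hg ⟨l, hl⟩ i (b + l) (fun r hr => (hi r hr).trans_le (by omega))
    refine ⟨_, hR.comp hR', fun s hs s' => ?_⟩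
    have hmap : ∀ y : ℕ → ℕ,
        i.map (fun r => if b ≤ r ∧ r < b + l then y (r - b) else s r) = i.map s := by
      intro y
      apply vector_map_congr
      intro r hr
      have := hi r hr
      rw [if_neg (by omega)]
    have hzero : ∀ y : ℕ → ℕ, ∀ r, b + l ≤ r →
        (fun r => if b ≤ r ∧ r < b + l then y (r - b) else s r) r = 0 := by
      intro y r hr
      simp only
      rw [if_neg (by omega), hs r (by omega)]
    constructor
    · rintro ⟨t, ht, hs'⟩
      obtain ⟨y, hy, rfl⟩ := (h s hs t).1 ht
      obtain ⟨z, hz, rfl⟩ := (h' _ (hzero y) s').1 hs'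
      rw [hmap] at hz
      refine ⟨update y l z, fun j hj => ?_, funext fun r => ?_⟩
      · by_cases hjl : (j : ℕ) = l
        · obtain rfl : j = ⟨l, hl⟩ := Fin.ext hjl
          simpa using hz
        · rw [update_of_ne hjl]
          exact hy j (by omega)
      · by_cases hr : r = b + l
        · subst hr
          simp
        · rw [update_of_ne hr]
          by_cases hr' : b ≤ r ∧ r < b + l
          · rw [if_pos hr', if_pos (by omega), update_of_ne (by omega)]
          · rw [if_neg hr', if_neg (by omega)]
    · rintro ⟨y, hy, rfl⟩
      refine ⟨_, (h s hs _).2 ⟨y, fun j hj => hy j (by omega), rfl⟩,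
        (h' _ (hzero y) _).2 ⟨y l, ?_, funext fun r => ?_⟩⟩
      · rw [hmap]
        exact hy ⟨l, hl⟩ (Nat.lt_succ_self l)
      · by_cases hr : r = b + l
        · subst hr
          simp
        · rw [update_of_ne hr]
          by_cases hr' : b ≤ r ∧ r < b + l
          · rw [if_pos hr', if_pos (by omega)]
          · rw [if_neg hr', if_neg (by omega)]

/-- Register `b` is kept free for the result: the arguments occupy `b + 1, …, b + n`, the value of
`f` appears in `b + 1 + n` and is moved to `b` once the arguments are cleared. -/
theorem Computes.comp {m n : ℕ} {f : List.Vector ℕ n →. ℕ} {g : Fin n → List.Vector ℕ m →. ℕ}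
    (hf : Computes f) (hg : ∀ j, Computes (g j)) :
    Computes fun v => (List.Vector.mOfFn fun j => g j v) >>= f := by
  intro i b hi
  obtain ⟨R, hR, h⟩ := exists_regularRel_comp_args hg i (b + 1)
    (fun r hr => (hi r hr).trans (Nat.lt_succ_self b)) n le_rfl
  obtain ⟨R', hR', h'⟩ := hf (List.Vector.ofFn fun j => b + 1 + j) (b + 1 + n) (by
    intro r hr
    rw [List.Vector.toList_ofFn, List.mem_ofFn] at hr
    obtain ⟨j, rfl⟩ := hr
    have := j.2
    omega)
  refine ⟨_, ((hR.comp hR').comp (regularRel_clear_range (b + 1) n)).comp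
    (regularRel_move (a := b + 1 + n) (b := b) (by omega)), fun s hs s' => ?_⟩
  have hs1 : ∀ r, b + 1 ≤ r → s r = 0 := fun r hr => hs r (by omega)
  have hzero : ∀ y : ℕ → ℕ, ∀ r, b + 1 + n ≤ r →
      (fun r => if b + 1 ≤ r ∧ r < b + 1 + n then y (r - (b + 1)) else s r) r = 0 := by
    intro y r hr
    simp only
    rw [if_neg (by omega), hs r (by omega)]
  have hmap : ∀ y : ℕ → ℕ, (List.Vector.ofFn fun j : Fin n => b + 1 + (j : ℕ)).map
      (fun r => if b + 1 ≤ r ∧ r < b + 1 + n then y (r - (b + 1)) else s r) =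
      List.Vector.ofFn fun j : Fin n => y j := by
    intro y
    ext j
    simp only [List.Vector.get_map, List.Vector.get_ofFn]
    rw [if_pos ⟨by omega, by omega⟩, Nat.add_sub_cancel_left]
  have hfin : ∀ (y : ℕ → ℕ) (z : ℕ) (u t : Regs),
      u = update (fun r => if b + 1 ≤ r ∧ r < b + 1 + n then y (r - (b + 1)) else s r)
        (b + 1 + n) z →
      t = (fun r => if b + 1 ≤ r ∧ r < b + 1 + n then 0 else u r) →
      update (update t b (t b + t (b + 1 + n))) (b + 1 + n) 0 = update s b z := by
    rintro y z _ _ rfl rfl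
    funext r
    have hb := hs b le_rfl
    have hr := hs r
    simp only [update_apply]
    split_ifs <;> omega
  constructor
  · rintro ⟨t, ⟨u, ⟨v, hv, hu⟩, ht⟩, rfl⟩
    obtain ⟨y, hy, rfl⟩ := (h s hs1 v).1 hv
    obtain ⟨z, hz, hu⟩ := (h' _ (hzero y) u).1 hu
    rw [hmap] at hz
    refine ⟨z, Part.mem_bind_iff.2 ⟨_, (mem_mOfFn_iff _ _).2 fun j => ?_, hz⟩, ?_⟩
    · simpa using hy j j.2
    · exact hfin y z u t hu ht
  · rintro ⟨z, hz, rfl⟩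
    obtain ⟨w, hw, hz⟩ := Part.mem_bind_iff.1 hz
    rw [mem_mOfFn_iff] at hw
    let y : ℕ → ℕ := fun j => if hj : j < n then w.get ⟨j, hj⟩ else 0
    refine ⟨_, ⟨_, ⟨_, (h s hs1 _).2 ⟨y, fun j _ => ?_, rfl⟩, (h' _ (hzero y) _).2 ⟨z, ?_, rfl⟩⟩,
      rfl⟩, ?_⟩
    · simpa [y] using hw j
    · rw [hmap]
      have : (List.Vector.ofFn fun j : Fin n => y j) = w := by
        ext j
        simp [y]
      rwa [this]
    · exact (hfin y z _ _ rfl rfl).symm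

/-- Register `b` holds the candidate and `b + 1` the value of `f` at it. A round of the loop
succeeds only for a positive value, by its decrement; the exit recomputes the value and tests it for
zero. Divergence shows as the lack of any successful exit. -/
theorem Computes.rfind {n : ℕ} {f : List.Vector ℕ (n + 1) → ℕ}
    (hf : Computes (f : List.Vector ℕ (n + 1) →. ℕ)) :
    Computes fun v => Nat.rfind fun m => Part.some (f (m ::ᵥ v) = 0) := by
  intro i b hi
  obtain ⟨F, hF, h⟩ := hf (b ::ᵥ i) (b + 1) (by
    intro r hr
    rcases List.mem_cons.1 (by simpa using hr) with rfl | hr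
    · omega
    · exact (hi r hr).trans (Nat.lt_succ_self b))
  refine ⟨_, (((hF.comp (regularRel_dec (b + 1))).comp (regularRel_clear (b + 1))).comp
    (regularRel_inc b)).star.comp (hF.comp (regularRel_zero (b + 1))), fun s hs s' => ?_⟩
  have hval : ∀ j t, F (update s b j) t ↔
      t = update (update s b j) (b + 1) (f (j ::ᵥ i.map s)) := by
    intro j t
    rw [h _ (by
      intro r hr
      rw [update_of_ne (by omega), hs r (by omega)])]
    have : (b ::ᵥ i).map (update s b j) = j ::ᵥ i.map s := by
      rw [List.Vector.map_cons, update_self]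
      congr 1
      apply vector_map_congr
      intro r hr
      rw [update_of_ne (hi r hr).ne]
    rw [this]
    simp
  have key := reflTransGen_iff_of_sequence (S := fun j => update s b j)
    (P := fun j => f (j ::ᵥ i.map s) ≠ 0)
    (R := Relation.Comp (Relation.Comp (Relation.Comp F
      (fun s s' => 0 < s (b + 1) ∧ s' = update s (b + 1) (s (b + 1) - 1)))
      (fun s s' => s' = update s (b + 1) 0)) (fun s s' => s' = update s b (s b + 1))) (by
      intro j _ t
      have hb := hs (b + 1) (by omega)
      have : ∀ x z, update (update (update (update (update s b j) (b + 1) x) (b + 1) z)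
          (b + 1) 0) b (j + 1) = update s b (j + 1) := by
        intro x z
        funext r
        simp only [update_apply]
        split_ifs <;> subst_vars <;> omega
      constructor
      · rintro ⟨_, ⟨_, ⟨_, hu, h0, rfl⟩, rfl⟩, rfl⟩
        rw [(hval _ _).1 hu] at h0 ⊢
        refine ⟨by simpa [Nat.pos_iff_ne_zero] using h0, ?_⟩
        rw [← this (f (j ::ᵥ i.map s)) (f (j ::ᵥ i.map s) - 1)]
        simp
      · rintro ⟨h0, rfl⟩
        refine ⟨_, ⟨_, ⟨_, (hval _ _).2 rfl, by simpa [Nat.pos_iff_ne_zero] using h0, rfl⟩, rfl⟩,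
          ?_⟩
        rw [← this (f (j ::ᵥ i.map s)) (f (j ::ᵥ i.map s) - 1)]
        simp)
  have h0 : update s b 0 = s := by rw [← hs b le_rfl, update_eq_self]
  simp only [h0] at key
  have hend : ∀ j, f (j ::ᵥ i.map s) = 0 →
      update (update s b j) (b + 1) (f (j ::ᵥ i.map s)) = update s b j := by
    intro j hj
    rw [hj, update_eq_self_iff, update_of_ne (by omega), hs _ (by omega)]
  constructor
  · rintro ⟨t, ht, u, hu, hz, rfl⟩
    obtain ⟨j, rfl, hj⟩ := (key t).1 ht
    obtain rfl := (hval _ _).1 hu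
    have hz : f (j ::ᵥ i.map s) = 0 := by simpa using hz
    refine ⟨j, Nat.mem_rfind.2 ⟨by simpa using hz, fun {m} hm => ?_⟩, hend j hz⟩
    simpa using hj m hm
  · rintro ⟨j, hj, rfl⟩
    obtain ⟨hz, hj⟩ := Nat.mem_rfind.1 hj
    have hz : f (j ::ᵥ i.map s) = 0 := by simpa using hz
    refine ⟨_, (key _).2 ⟨j, rfl, fun m hm => ?_⟩, _, (hval _ _).2 rfl, by simpa using hz,
      (hend j hz).symm⟩
    simpa using hj hm

/-- Register `b` holds the current value, `b + 1` the number of rounds left, `b + 2` the index of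
the round and `b + 3` the next value, which then replaces the one in `b`. -/
theorem Computes.prec {n : ℕ} {f : List.Vector ℕ n → ℕ} {g : List.Vector ℕ (n + 2) → ℕ}
    (hf : Computes (f : List.Vector ℕ n →. ℕ)) (hg : Computes (g : List.Vector ℕ (n + 2) →. ℕ)) :
    Computes ((fun v : List.Vector ℕ (n + 1) =>
      v.head.rec (f v.tail) fun y ih => g (y ::ᵥ ih ::ᵥ v.tail) : List.Vector ℕ (n + 1) → ℕ) :
        List.Vector ℕ (n + 1) →. ℕ) := by
  intro i b hi
  obtain ⟨a, i, rfl⟩ : ∃ a i', i = a ::ᵥ i' := ⟨i.head, i.tail, by simp⟩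
  have ha : a < b := hi a (by simp)
  have hi : ∀ r ∈ i.toList, r < b := fun r hr => hi r (by simp [hr])
  obtain ⟨F, hF, hF'⟩ := hf i b hi
  obtain ⟨C, hC, hC'⟩ := exists_regularRel_copy (a := a) (b := b + 1) (c := b + 2)
    (by omega) (by omega) (by omega)
  obtain ⟨G, hG, hG'⟩ := hg ((b + 2) ::ᵥ b ::ᵥ i) (b + 3) (by
    intro r hr
    have : r = b + 2 ∨ r = b ∨ r ∈ i.toList := by simpa using hr
    rcases this with rfl | rfl | hr
    · omega
    · omega
    · exact (hi r hr).trans (by omega))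
  refine ⟨_, ((hF.comp hC).comp ((((((regularRel_dec (b + 1)).comp hG).comp
    (regularRel_clear b)).comp (regularRel_move (a := b + 3) (b := b) (by omega))).comp
    (regularRel_inc (b + 2))).star.comp (regularRel_zero (b + 1)))).comp
    (regularRel_clear (b + 2)), fun s hs s' => ?_⟩
  have e0 := hs b le_rfl
  have e1 := hs (b + 1) (by omega)
  have e2 := hs (b + 2) (by omega)
  have e3 := hs (b + 3) (by omega)
  let v : ℕ → ℕ := fun j => Nat.rec (f (i.map s)) (fun y ih => g (y ::ᵥ ih ::ᵥ i.map s)) j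
  let S : ℕ → Regs := fun j =>
    update (update (update s b (v j)) (b + 1) (s a - j)) (b + 2) j
  have hinit : ∀ t, Relation.Comp F C s t ↔ t = S 0 := by
    intro t
    have hval : ∀ u, F s u ↔ u = update s b (v 0) := by
      intro u
      rw [hF' s hs]
      simp [v]
    have hcopy : C (update s b (v 0)) t ↔ t = S 0 := by
      rw [hC' _ _ (by rw [update_of_ne (by omega), e2])]
      have : update (update s b (v 0)) (b + 1)
          (update s b (v 0) (b + 1) + update s b (v 0) a) = S 0 := by
        funext r
        simp only [S, update_apply]
        split_ifs <;> subst_vars <;> omega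
      rw [this]
    constructor
    · rintro ⟨u, hu, ht⟩
      rw [(hval u).1 hu] at ht
      exact hcopy.1 ht
    · exact fun ht => ⟨_, (hval _).2 rfl, hcopy.2 ht⟩
  have hloop := countdown_iff (S := S) (r := b + 1) (m := s a)
    (R := Relation.Comp (Relation.Comp (Relation.Comp (Relation.Comp
      (fun s s' => 0 < s (b + 1) ∧ s' = update s (b + 1) (s (b + 1) - 1)) G)
      (fun s s' => s' = update s b 0))
      (fun s s' => s' = update (update s b (s b + s (b + 3))) (b + 3) 0))
      (fun s s' => s' = update s (b + 2) (s (b + 2) + 1)))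
    (by
      intro j _
      simp [S]) (by
      intro j hj t
      have hS1 : S j (b + 1) = s a - j := by simp [S]
      have hGval : ∀ u, G (update (S j) (b + 1) (s a - j - 1)) u ↔
          u = update (update (S j) (b + 1) (s a - j - 1)) (b + 3) (v (j + 1)) := by
        intro u
        rw [hG' _ (by
          intro r hr
          simp only [S]
          rw [update_of_ne (by omega), update_of_ne (by omega), update_of_ne (by omega),
            update_of_ne (by omega), hs r (by omega)])]
        have : ((b + 2) ::ᵥ b ::ᵥ i).map (update (S j) (b + 1) (s a - j - 1)) =
            j ::ᵥ v j ::ᵥ i.map s := by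
          rw [List.Vector.map_cons, List.Vector.map_cons]
          congr 1
          · simp [S]
          congr 1
          · simp [S]
          · apply vector_map_congr
            intro r hr
            have := hi r hr
            simp only [S]
            rw [update_of_ne (by omega), update_of_ne (by omega), update_of_ne (by omega),
              update_of_ne (by omega)]
        rw [this]
        simp [v]
      have hfin : ∀ u : Regs,
          u = update (update (S j) (b + 1) (s a - j - 1)) (b + 3) (v (j + 1)) → ∀ w : Regs,
          w = update u b 0 → ∀ x : Regs, x = update (update w b (w b + w (b + 3))) (b + 3) 0 →
          update x (b + 2) (x (b + 2) + 1) = S (j + 1) := by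
        rintro _ rfl _ rfl _ rfl
        funext r
        simp only [S, update_apply]
        split_ifs <;> subst_vars <;> omega
      constructor
      · rintro ⟨x, ⟨w, ⟨u, ⟨y, ⟨hy0, hy⟩, hu⟩, hw⟩, hx⟩, ht⟩
        rw [hS1] at hy0 hy
        rw [hy] at hu
        exact ⟨by omega, ht.trans (hfin u ((hGval u).1 hu) w hw x hx)⟩
      · rintro ⟨hj', rfl⟩
        refine ⟨_, ⟨_, ⟨_, ⟨_, ⟨by rw [hS1]; omega, rfl⟩, ?_⟩, rfl⟩, rfl⟩,
          (hfin _ rfl _ rfl _ rfl).symm⟩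
        rw [hS1]
        exact (hGval _).2 rfl)
  have hlast : update (S (s a)) (b + 2) 0 = update s b (v (s a)) := by
    funext r
    simp only [S, update_apply]
    split_ifs <;> subst_vars <;> omega
  have : (∃ y ∈ ((fun v : List.Vector ℕ (n + 1) =>
      v.head.rec (f v.tail) fun y ih => g (y ::ᵥ ih ::ᵥ v.tail) : List.Vector ℕ (n + 1) → ℕ) :
        List.Vector ℕ (n + 1) →. ℕ) ((a ::ᵥ i).map s), s' = update s b y) ↔
      s' = update s b (v (s a)) := by
    simp [v]
  rw [this, ← hlast]
  constructor
  · rintro ⟨t, ⟨u, hu, ht⟩, rfl⟩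
    rw [(hinit u).1 hu] at ht
    rw [(hloop t).1 ht]
  · rintro rfl
    exact ⟨_, ⟨_, (hinit _).2 rfl, (hloop _).2 rfl⟩, rfl⟩

theorem computes_of_primrec' {n : ℕ} {f : List.Vector ℕ n → ℕ} (hf : Nat.Primrec' f) :
    Computes (f : List.Vector ℕ n →. ℕ) := by
  induction hf with
  | zero => exact computes_zero
  | succ => exact computes_succ
  | get j => exact computes_get j
  | comp g _ _ hf hg =>
    refine (congrArg Computes (funext fun v => ?_)).mp (hf.comp hg)
    simp only [PFun.coe_val, Vector.mOfFn_part_some]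
    exact Part.bind_some _ _
  | prec _ _ hf hg => exact hf.prec hg

theorem computes_of_partrec' {n : ℕ} {f : List.Vector ℕ n →. ℕ} (hf : Nat.Partrec' f) :
    Computes f := by
  induction hf with
  | prim hf => exact computes_of_primrec' hf
  | comp g _ _ hf hg => exact hf.comp hg
  | rfind _ hf => exact hf.rfind

end RegisterTrace

/-! ### Automata for the domains of partial recursive functions -/

namespace RegisterTrace

open Instruction Function

theorem exec_map_val {K : ℕ} (w : List (Instruction (Fin K))) (s : Regs) :
    (∃ s', Exec (w.map (Prod.map Fin.val id)) s s') ↔ ∃ s', Exec w (fun r => s r) s' := by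
  induction w generalizing s with
  | nil => simp [Exec]
  | cons i w ih =>
    have heff : ∀ (r : Fin K) m m',
        Effect (Prod.map Fin.val id i) (r : ℕ) m m' ↔ Effect i r m m' := by
      intro r m m'
      simp [Effect, Fin.ext_iff]
    constructor
    · rintro ⟨s', t, ht, h⟩
      obtain ⟨t', h'⟩ := (ih t).1 ⟨s', h⟩
      exact ⟨t', _, fun r => (heff r _ _).1 (ht r), h'⟩
    · rintro ⟨s', t, ht, h⟩
      -- Registers from `K` on occur in no instruction and keep their contents.
      let t' : Regs := fun r => if hr : r < K then t ⟨r, hr⟩ else s r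
      have ht' : (fun r : Fin K => t' r) = t := by
        funext r
        simp [t']
      obtain ⟨s'', h⟩ := (ih t').2 ⟨s', by rwa [ht']⟩
      refine ⟨s'', t', fun r => ?_, h⟩
      by_cases hr : r < K
      · have := (heff ⟨r, hr⟩ _ _).2 (ht ⟨r, hr⟩)
        simpa [t', hr] using this
      · have hne : (i.1 : ℕ) ≠ r := by
          have := i.1.2
          omega
        simp [Effect, t', hr, hne]

/-- The domain of a partial recursive function is described by the executable words of a regular
language of instructions. -/
theorem exists_dfa_of_partrec {f : ℕ →. ℕ} (hf : Partrec f) :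
    ∃ (K : ℕ) (σ : Type) (_ : Fintype σ) (D : DFA (Instruction (Fin (K + 1))) σ),
      ∀ n, (f n).Dom ↔ ∃ w ∈ D.accepts, ∃ s', Exec w (fun r => if r = 0 then n else 0) s' := by
  -- The input is in register 0 and the result in register 1; only the existence of a result
  -- matters.
  obtain ⟨R, ⟨L, ⟨σ, hσ, D, rfl⟩, ⟨K, hK⟩, hR⟩, hRf⟩ :=
    computes_of_partrec' (Nat.Partrec'.part_iff₁.2 hf) (0 ::ᵥ .nil) 1 (by simp)
  refine ⟨K, σ, hσ, D.comap (Prod.map Fin.val id), fun n => ?_⟩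
  let s : Regs := fun r => if r = 0 then n else 0
  have hs : ∀ r, 1 ≤ r → s r = 0 := fun r hr => if_neg (by omega)
  have hs' : (fun r : Fin (K + 1) => s r) = fun r => if r = 0 then n else 0 := by
    funext r
    simp [s]
  have h1 : (f n).Dom ↔ ∃ s', R s s' := by
    simp only [hRf s hs, Part.dom_iff_mem]
    constructor
    · rintro ⟨y, hy⟩
      exact ⟨_, y, by simpa [s] using hy, rfl⟩
    · rintro ⟨_, y, hy, -⟩
      exact ⟨y, by simpa [s] using hy⟩
  rw [h1]
  simp only [← hs', ← exec_map_val, hR]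
  constructor
  · rintro ⟨s', w, hw, h⟩
    -- Words of the language use only registers below `K`, so they lift to `Fin (K + 1)`; the extra
    -- register ensures that register 0 exists.
    have : ∃ w' : List (Instruction (Fin (K + 1))), w = w'.map (Prod.map Fin.val id) := by
      refine ⟨w.attach.map fun i => (⟨i.1.1, (hK w hw _ i.2).trans (Nat.lt_succ_self K)⟩, i.1.2),
        ?_⟩
      rw [List.map_map]
      conv_lhs => rw [← List.attach_map_subtype_val w]
      rfl
    obtain ⟨w', rfl⟩ := this
    refine ⟨w', ?_, s', h⟩
    rw [DFA.accepts_comap]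
    exact hw
  · rintro ⟨w, hw, s', h⟩
    rw [DFA.accepts_comap] at hw
    exact ⟨s', _, hw, h⟩

end RegisterTrace

/-! ### Histories and their errors -/

/-- The letters of histories: `Sum.inl r` stands for a unit in register `r`. -/
abbrev Letter (ρ : Type) : Type := ρ ⊕ Instruction ρ

namespace History

open Instruction

variable {ρ : Type} [DecidableEq ρ]

/-- The instructions in a history. -/
def instructions : List (Letter ρ) → List (Instruction ρ)
  | [] => []
  | .inl _ :: u => instructions u
  | .inr i :: u => i :: instructions u

/-- The content of register `r` noted before the first instruction. -/
def content (r : ρ) : List (Letter ρ) → ℕ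
  | [] => 0
  | .inl a :: u => (if a = r then 1 else 0) + content r u
  | .inr _ :: _ => 0

/-- The first instruction does not change register `r` from `m` plus the noted content to the
content noted after the instruction. -/
def FirstWrong (r : ρ) (m : ℕ) : List (Letter ρ) → Prop
  | [] => False
  | .inl a :: u => FirstWrong r (m + if a = r then 1 else 0) u
  | .inr i :: u => ¬ Effect i r m (content r u)

/-- Some instruction after the first is wrong for register `r`. -/
def LaterWrong (r : ρ) : List (Letter ρ) → Prop
  | [] => False
  | .inl _ :: u => LaterWrong r u
  | .inr _ :: u => FirstWrong r 0 u ∨ LaterWrong r u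

/-- Instruction number `m + 1` is wrong for register `r`, where the first has number `0`. -/
def WrongAfter (r : ρ) : ℕ → List (Letter ρ) → Prop
  | _, [] => False
  | m, .inl _ :: u => WrongAfter r m u
  | 0, .inr _ :: u => FirstWrong r 0 u
  | m + 1, .inr _ :: u => WrongAfter r m u

/-- The contents before the first instruction are not noted as `n` units in register `r`. -/
def InitWrong (r : ρ) : ℕ → List (Letter ρ) → Prop
  | 0, [] => False
  | 0, .inl _ :: _ => True
  | 0, .inr _ :: _ => False
  | _ + 1, [] => True
  | n + 1, .inl a :: u => if a = r then InitWrong r n u else True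
  | _ + 1, .inr _ :: _ => True

theorem exists_wrongAfter_iff (r : ρ) (u : List (Letter ρ)) :
    (∃ m, WrongAfter r m u) ↔ LaterWrong r u := by
  induction u with
  | nil => simp [WrongAfter, LaterWrong]
  | cons x u ih =>
    rcases x with a | i
    · simpa [WrongAfter, LaterWrong] using ih
    · rw [LaterWrong, ← ih]
      constructor
      · rintro ⟨_ | m, h⟩
        · exact Or.inl h
        · exact Or.inr ⟨m, h⟩
      · rintro (h | ⟨m, h⟩)
        · exact ⟨0, h⟩
        · exact ⟨m + 1, h⟩

theorem content_of_not_initWrong {r₀ : ρ} {n : ℕ} {u : List (Letter ρ)}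
    (h : ¬ InitWrong r₀ n u) (r : ρ) : content r u = if r = r₀ then n else 0 := by
  induction u generalizing n with
  | nil => cases n <;> simp_all [InitWrong, content]
  | cons x u ih =>
    rcases x with a | i
    · rcases n with _ | n
      · simp [InitWrong] at h
      · by_cases ha : a = r₀
        · subst ha
          simp only [InitWrong, if_true] at h
          rw [content, ih h]
          simp only [eq_comm (a := a)]
          split_ifs <;> omega
        · simp [InitWrong, ha] at h
    · cases n <;> simp_all [InitWrong, content]

/-- Here `m r` is the part of the current block that has already been read. Each instruction, being
right for all registers, leads from the contents noted before it to those noted after it. -/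
theorem exists_exec_of_right {u : List (Letter ρ)} {m : ρ → ℕ}
    (h : ∀ r, ¬ FirstWrong r (m r) u ∧ ¬ LaterWrong r u) :
    ∃ s', Exec (instructions u) (fun r => m r + content r u) s' := by
  induction u generalizing m with
  | nil => exact ⟨_, rfl⟩
  | cons x u ih =>
    rcases x with a | i
    · obtain ⟨s', hs'⟩ := ih (m := fun r => m r + if a = r then 1 else 0) h
      refine ⟨s', ?_⟩
      simpa only [content, instructions, add_assoc] using hs'
    · obtain ⟨s', hs'⟩ := ih (m := fun _ => 0) fun r => not_or.1 (h r).2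
      refine ⟨s', _, fun r => ?_, hs'⟩
      simpa [FirstWrong, content] using (h r).1

theorem instructions_block {ρ : Type} (b : List ρ) (u : List (Letter ρ)) :
    instructions (b.map Sum.inl ++ u) = instructions u := by
  induction b with
  | nil => simp
  | cons a b ih => simpa [instructions] using ih

section Block

variable (b : List ρ) (u : List (Letter ρ)) (r : ρ)

theorem content_block : content r (b.map Sum.inl ++ u) = b.count r + content r u := by
  induction b with
  | nil => simp
  | cons a b ih =>
    simp only [List.map_cons, List.cons_append, content, ih, List.count_cons, beq_iff_eq]
    omega

theorem firstWrong_block (m : ℕ) :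
    FirstWrong r m (b.map Sum.inl ++ u) ↔ FirstWrong r (m + b.count r) u := by
  induction b generalizing m with
  | nil => simp
  | cons a b ih =>
    simp only [List.map_cons, List.cons_append, FirstWrong, ih, List.count_cons, beq_iff_eq]
    rw [add_right_comm, add_assoc]

theorem laterWrong_block : LaterWrong r (b.map Sum.inl ++ u) ↔ LaterWrong r u := by
  induction b with
  | nil => simp
  | cons a b ih => simpa [LaterWrong] using ih

theorem initWrong_replicate (n : ℕ) :
    InitWrong r n ((List.replicate n r).map Sum.inl ++ u) ↔ InitWrong r 0 u := by
  induction n with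
  | zero => simp
  | succ n ih => simpa [List.replicate_succ, InitWrong] using ih

end Block

theorem exists_list_count_eq [Fintype ρ] (t : ρ → ℕ) : ∃ b : List ρ, ∀ r, b.count r = t r := by
  refine ⟨(∑ r, t r • ({r} : Multiset ρ)).toList, fun r => ?_⟩
  rw [← Multiset.coe_count, Multiset.coe_toList, Multiset.count_sum']
  simp [Multiset.count_singleton]

/-- The history is built from the end, inserting after each instruction a block that notes the
contents reached; finitely many registers make such a block a word. No block precedes the first
instruction, so that any block can still be put in front. -/
theorem exists_right_of_exec [Fintype ρ] {w : List (Instruction ρ)} {s s' : ρ → ℕ}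
    (h : Exec w s s') : ∃ u, instructions u = w ∧ (∀ r, ¬ InitWrong r 0 u) ∧
      (∀ r, content r u = 0) ∧ ∀ r, ¬ FirstWrong r (s r) u ∧ ¬ LaterWrong r u := by
  induction w generalizing s with
  | nil => exact ⟨[], by simp [instructions, InitWrong, content, FirstWrong, LaterWrong]⟩
  | cons i w ih =>
    obtain ⟨t, ht, h⟩ := h
    obtain ⟨u, hw, -, hc, hu⟩ := ih h
    obtain ⟨b, hb⟩ := exists_list_count_eq t
    refine ⟨.inr i :: (b.map Sum.inl ++ u), ?_, by simp [InitWrong], by simp [content],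
      fun r => ⟨?_, ?_⟩⟩
    · rw [instructions, instructions_block, hw]
    · rw [FirstWrong, content_block, hb, hc, not_not]
      exact ht r
    · rw [LaterWrong, firstWrong_block, laterWrong_block, hb, zero_add]
      exact not_or.2 (hu r)

/-- The histories without any error correspond to the executable words of instructions. -/
theorem exists_right_iff [Fintype ρ] (L : Language (Instruction ρ)) (r₀ : ρ) (n : ℕ) :
    (∃ u, ¬ InitWrong r₀ n u ∧ instructions u ∈ L ∧
      ∀ r, ¬ FirstWrong r 0 u ∧ ¬ LaterWrong r u) ↔
      ∃ w ∈ L, ∃ s', Exec w (fun r => if r = r₀ then n else 0) s' := by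
  constructor
  · rintro ⟨u, hn, hL, hu⟩
    obtain ⟨s', h⟩ := exists_exec_of_right (m := fun _ => 0) hu
    refine ⟨_, hL, s', ?_⟩
    simpa only [zero_add, content_of_not_initWrong hn] using h
  · rintro ⟨w, hL, s', h⟩
    obtain ⟨u, rfl, hi, -, hu⟩ := exists_right_of_exec h
    refine ⟨(List.replicate n r₀).map Sum.inl ++ u, ?_, ?_, fun r => ?_⟩
    · rw [initWrong_replicate]
      exact hi r₀
    · rwa [instructions_block]
    · rw [firstWrong_block, laterWrong_block, List.count_replicate, zero_add]
      simpa only [beq_iff_eq, eq_comm (a := r₀)] using hu r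

end History

/-! ### The machine that looks for errors -/

/-- The states of the machine that looks for an error in a history. -/
inductive CheckState (ρ σ : Type) : Type
  | start
  | accepting
  | found
  | toInit
  | toProgram
  | program (q : σ)
  | load (r : ρ)
  | seek (r : ρ)
  | before (r : ρ)
  | after (r : ρ)
  | init (j : ℕ)

namespace CheckState

variable {k : ℕ} {ρ σ : Type}

/-- Change only the counter `o`, if there is one, by `d`. -/
def change (o : Option (Fin k)) (d : SignType) : Fin k → SignType :=
  fun i => if o = some i then d else 0

/-- The decision whether the next instruction is the one to be checked: by the counter `pos`, or
by a guess if there is none. -/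
def enter (pos : Option (Fin k)) (r : ρ) (t : Fin k → Bool) :
    List (CheckState ρ σ × (Fin k → SignType)) :=
  match pos with
  | none => [(seek r, 0), (before r, 0)]
  | some p => if t p then [(seek r, change (some p) (-1))] else [(before r, 0)]

variable [DecidableEq ρ]

open Classical in
/-- The moves of the machine that accepts the words `w $ u $` such that `u` has the error which
is described by `w`. The first letter of `w` selects the kind of error, the length of `w` its
position. The symbol `none` is the marker. -/
noncomputable def next (D : DFA (Instruction ρ) σ) (r₀ : ρ) (pos : Option (Fin k)) (cmp : Fin k)
    (n : ℕ) : CheckState ρ σ → Option (Letter ρ) → (Fin k → Bool) →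
      List (CheckState ρ σ × (Fin k → SignType))
  | start, none, _ => []
  | start, some (.inl r), _ => [(load r, 0)]
  | start, some (.inr i), _ => if i.2 = 0 then [(toInit, 0)] else [(toProgram, 0)]
  | accepting, _, _ => []
  | found, none, _ => [(accepting, 0)]
  | found, some _, _ => [(found, 0)]
  | toInit, none, _ => [(init n, 0)]
  | toInit, some _, _ => []
  | toProgram, none, _ => [(program D.start, 0)]
  | toProgram, some _, _ => []
  | program q, none, _ => if q ∈ D.accept then [] else [(accepting, 0)]
  | program q, some (.inl _), _ => [(program q, 0)]
  | program q, some (.inr i), _ => [(program (D.step q i), 0)]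
  | load r, none, t => enter pos r t
  | load r, some _, _ => [(load r, change pos 1)]
  | seek _, none, _ => []
  | seek r, some (.inl _), _ => [(seek r, 0)]
  | seek r, some (.inr _), t => enter pos r t
  | before _, none, _ => []
  | before r, some (.inl a), _ => [(before r, change (some cmp) (if a = r then 1 else 0))]
  | before r, some (.inr i), t =>
      if i.1 = r then
        if i.2 = 1 then [(after r, change (some cmp) 1)]
        else if i.2 = -1 then
          if t cmp then [(after r, change (some cmp) (-1))] else [(found, 0)]
        else if t cmp then [(found, 0)] else [(after r, 0)]
      else [(after r, 0)]
  | after _, none, t => if t cmp then [(accepting, 0)] else []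
  | after r, some (.inl a), t =>
      if a = r then
        if t cmp then [(after r, change (some cmp) (-1))] else [(found, 0)]
      else [(after r, 0)]
  | after _, some (.inr _), t => if t cmp then [(found, 0)] else []
  | init 0, none, _ => []
  | init 0, some (.inl _), _ => [(found, 0)]
  | init 0, some (.inr _), _ => []
  | init (_ + 1), none, _ => [(accepting, 0)]
  | init (j + 1), some (.inl a), _ => if a = r₀ then [(init j, 0)] else [(found, 0)]
  | init (_ + 1), some (.inr _), _ => [(found, 0)]

/-- Acceptance of the remaining input from a state and counter contents. -/
def Accepts (D : DFA (Instruction ρ) σ) (r₀ : ρ) (pos : Option (Fin k)) (cmp : Fin k) (n : ℕ) :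
    CheckState ρ σ → (Fin k → ℕ) → List (Option (Letter ρ)) → Prop
  | q, _, [] => q = accepting
  | q, c, x :: u => ∃ m ∈ next D r₀ pos cmp n q x (fun i => decide (0 < c i)),
      Accepts D r₀ pos cmp n m.1 (fun i => ((c i : ℤ) + (m.2 i : ℤ)).toNat) u

/-- The contents `m` of the counter `o`, if there is one, all others being zero. -/
def single (o : Option (Fin k)) (m : ℕ) : Fin k → ℕ := fun i => if o = some i then m else 0

section Accepts

open History

variable {D : DFA (Instruction ρ) σ} {r₀ : ρ} {pos : Option (Fin k)} {cmp : Fin k} {n : ℕ}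

theorem accepts_found (c : Fin k → ℕ) (u : List (Letter ρ)) :
    Accepts D r₀ pos cmp n found c (u.map some ++ [none]) := by
  induction u generalizing c with
  | nil => simp [Accepts, next]
  | cons x u ih => simpa [Accepts, next] using ih c

theorem accepts_program (q : σ) (c : Fin k → ℕ) (u : List (Letter ρ)) :
    Accepts D r₀ pos cmp n (program q) c (u.map some ++ [none]) ↔
      D.evalFrom q (instructions u) ∉ D.accept := by
  induction u generalizing q c with
  | nil => by_cases h : q ∈ D.accept <;> simp [Accepts, next, instructions, h]
  | cons x u ih =>
    rcases x with a | i
    · simpa [Accepts, next, instructions] using ih q c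
    · simpa [Accepts, next, instructions] using ih (D.step q i) c

theorem accepts_init (j : ℕ) (c : Fin k → ℕ) (u : List (Letter ρ)) :
    Accepts D r₀ pos cmp n (init j) c (u.map some ++ [none]) ↔ InitWrong r₀ j u := by
  induction u generalizing j c with
  | nil => cases j <;> simp [Accepts, next, InitWrong]
  | cons x u ih =>
    rcases j with _ | j <;> rcases x with a | i
    · simpa [Accepts, next, InitWrong] using accepts_found c u
    · simp [Accepts, next, InitWrong]
    · by_cases h : a = r₀
      · simpa [Accepts, next, InitWrong, h] using ih j c
      · simpa [Accepts, next, InitWrong, h] using accepts_found c u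
    · simpa [Accepts, next, InitWrong] using accepts_found c u

/-- The counter goes down with each unit of `r`. A unit left when it is zero, or a positive counter
at the end of the block, reveals a mismatch; equality leads to rejection. -/
theorem accepts_after (r : ρ) (c : Fin k → ℕ) (u : List (Letter ρ)) :
    Accepts D r₀ pos cmp n (after r) c (u.map some ++ [none]) ↔ content r u ≠ c cmp := by
  induction u generalizing c with
  | nil =>
    by_cases h : 0 < c cmp
    · simp [Accepts, next, content, h, h.ne]
    · simp [Accepts, next, content, h]
      omega
  | cons x u ih =>
    rcases x with a | i
    · by_cases ha : a = r
      · by_cases h : 0 < c cmp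
        · simp [Accepts, next, content, h, ha, ih, change]
          omega
        · simp [Accepts, next, content, h, ha]
          have := accepts_found (D := D) (r₀ := r₀) (pos := pos) (cmp := cmp) (n := n) c u
          simp [this]
          omega
      · simpa [Accepts, next, content, ha] using ih c
    · by_cases h : 0 < c cmp
      · have := accepts_found (D := D) (r₀ := r₀) (pos := pos) (cmp := cmp) (n := n) c u
        simp [Accepts, next, content, h, h.ne, this]
      · simp [Accepts, next, content, h]
        omega

/-- The counter adds the units of `r` in the block and then undergoes the instruction, and the next
block is compared with the outcome. A decrement or zero test that is impossible is an error at once.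
-/
theorem accepts_before (r : ρ) (c : Fin k → ℕ) (u : List (Letter ρ)) :
    Accepts D r₀ pos cmp n (before r) c (u.map some ++ [none]) ↔ FirstWrong r (c cmp) u := by
  induction u generalizing c with
  | nil => simp [Accepts, next, FirstWrong]
  | cons x u ih =>
    rcases x with a | ⟨a, d⟩
    · by_cases ha : a = r
      · simp [Accepts, next, FirstWrong, ha, ih, change]
      · simp [Accepts, next, FirstWrong, ha, ih, change]
    · by_cases ha : a = r
      · have hf := accepts_found (D := D) (r₀ := r₀) (pos := pos) (cmp := cmp) (n := n) c u
        cases d <;> by_cases h : 0 < c cmp <;>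
          simp [Accepts, next, FirstWrong, ha, change, h, accepts_after, Instruction.Effect, hf]
            <;> omega
      · simp [Accepts, next, FirstWrong, ha, accepts_after, Instruction.Effect]

end Accepts

end CheckState

/-! ### Acceptance means an error -/

namespace CheckState

open History

variable {k : ℕ} {ρ σ : Type} [DecidableEq ρ] {D : DFA (Instruction ρ) σ} {r₀ : ρ}
  {pos : Option (Fin k)} {cmp : Fin k} {n : ℕ}

theorem exists_mem_enter_none (r : ρ) (u : List (Letter ρ)) :
    (∃ m ∈ enter none r (fun i => decide (0 < (fun _ : Fin k => 0) i)),
      Accepts D r₀ none cmp n m.1 (fun i => (((0 : ℕ) : ℤ) + (m.2 i : ℤ)).toNat)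
        (u.map some ++ [none])) ↔ FirstWrong r 0 u ∨ LaterWrong r u := by
  have hseek : Accepts D r₀ none cmp n (seek r) (fun _ => 0) (u.map some ++ [none]) ↔
      LaterWrong r u := by
    induction u with
    | nil => simp [Accepts, next, LaterWrong]
    | cons x u ih =>
      rcases x with a | i
      · simpa [Accepts, next, LaterWrong] using ih
      · simp [Accepts, next, LaterWrong, enter, accepts_before, ih, or_comm]
  simp [enter, accepts_before, hseek, or_comm]

theorem exists_mem_enter_some (p : Fin k) (r : ρ) (m : ℕ) (u : List (Letter ρ)) :
    (∃ x ∈ enter (some p) r (fun i => decide (0 < single (some p) m i)),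
      Accepts D r₀ (some p) cmp n x.1 (fun i => ((single (some p) m i : ℤ) + (x.2 i : ℤ)).toNat)
        (u.map some ++ [none])) ↔
      match m with
      | 0 => FirstWrong r 0 u
      | m + 1 => WrongAfter r m u := by
  have hz : single (some p) 0 = fun _ => 0 := by
    funext i
    simp [single]
  have hdec : ∀ m, (fun i => ((single (some p) (m + 1) i : ℤ) +
      ((change (some p) (-1) i : SignType) : ℤ)).toNat) = single (some p) m := by
    intro m
    funext i
    by_cases h : p = i <;> simp [single, change, h]
  have hp : ∀ m, single (some p) m p = m := fun m => by simp [single]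
  have hseek : ∀ m, Accepts D r₀ (some p) cmp n (seek r) (single (some p) m)
      (u.map some ++ [none]) ↔ WrongAfter r m u := by
    induction u with
    | nil => simp [Accepts, next, WrongAfter]
    | cons x u ih =>
      intro m
      rcases x with a | i
      · simpa [Accepts, next, WrongAfter] using ih m
      · rcases m with _ | m
        · simp [Accepts, next, WrongAfter, enter, accepts_before, hz]
        · simpa [Accepts, next, WrongAfter, enter, hp, hdec] using ih m
  rcases m with _ | m
  · simp [enter, accepts_before, hz]
  · simpa [enter, hp, hdec] using hseek m

theorem accepts_load (r : ρ) (m : ℕ) (w : List (Letter ρ)) (u : List (Option (Letter ρ))) :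
    Accepts D r₀ pos cmp n (load r) (single pos m) (w.map some ++ none :: u) ↔
      ∃ x ∈ enter pos r (fun i => decide (0 < single pos (m + w.length) i)),
        Accepts D r₀ pos cmp n x.1
          (fun i => ((single pos (m + w.length) i : ℤ) + (x.2 i : ℤ)).toNat) u := by
  induction w generalizing m with
  | nil => simp [Accepts, next]
  | cons x w ih =>
    have hinc : (fun i => ((single pos m i : ℤ) + ((change pos 1 i : SignType) : ℤ)).toNat) =
        single pos (m + 1) := by
      funext i
      by_cases h : pos = some i <;> simp [single, change, h]
    simp only [List.map_cons, List.cons_append, Accepts, next, List.mem_singleton,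
      exists_eq_left, hinc, ih, List.length_cons]
    rw [Nat.add_right_comm, Nat.add_assoc]

theorem exists_accepts_load (r : ρ) (u : List (Letter ρ)) :
    (∃ w : List (Letter ρ), Accepts D r₀ pos cmp n (load r) (fun _ => 0)
      (w.map some ++ none :: (u.map some ++ [none]))) ↔ FirstWrong r 0 u ∨ LaterWrong r u := by
  have hz : (fun _ => 0) = single pos 0 := by
    funext i
    simp [single]
  simp only [hz, accepts_load, zero_add]
  rcases pos with _ | p
  · have hs : ∀ m, (single none m : Fin k → ℕ) = fun _ => 0 := fun m => by
      funext i
      simp [single]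
    simp only [hs, exists_mem_enter_none, exists_const]
  · simp only [exists_mem_enter_some]
    rw [← exists_wrongAfter_iff]
    constructor
    · rintro ⟨w, h⟩
      generalize w.length = m at h
      rcases m with _ | m
      · exact Or.inl h
      · exact Or.inr ⟨m, h⟩
    · rintro (h | ⟨m, h⟩)
      · exact ⟨[], h⟩
      -- Only the length of this word matters: the machine spends one unit on leaving the marker and
      -- `m` on skipping instructions.
      · refine ⟨List.replicate (m + 1) (.inl r), ?_⟩
        rw [List.length_replicate]
        exact h

/-- The words `w $ u $` are accepted for some `w` if and only if `u` has an error. -/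
theorem exists_accepts_start (u : List (Letter ρ)) :
    (∃ w : List (Letter ρ), Accepts D r₀ pos cmp n start (fun _ => 0)
      (w.map some ++ none :: (u.map some ++ [none]))) ↔
      InitWrong r₀ n u ∨ instructions u ∉ D.accepts ∨
        ∃ r, FirstWrong r 0 u ∨ LaterWrong r u := by
  have hI : ∀ w : List (Letter ρ), Accepts D r₀ pos cmp n toInit (fun _ => 0)
      (w.map some ++ none :: (u.map some ++ [none])) ↔ w = [] ∧ InitWrong r₀ n u := by
    rintro (_ | ⟨x, w⟩)
    · simpa [Accepts, next] using accepts_init n _ u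
    · simp [Accepts, next]
  have hP : ∀ w : List (Letter ρ), Accepts D r₀ pos cmp n toProgram (fun _ => 0)
      (w.map some ++ none :: (u.map some ++ [none])) ↔
        w = [] ∧ instructions u ∉ D.accepts := by
    rintro (_ | ⟨x, w⟩)
    · simpa [Accepts, next] using! accepts_program D.start _ u
    · simp [Accepts, next]
  simp only [← exists_accepts_load (D := D) (r₀ := r₀) (pos := pos) (cmp := cmp) (n := n)]
  constructor
  · rintro ⟨_ | ⟨r | ⟨r, d⟩, w⟩, h⟩
    · simp [Accepts, next] at h
    · exact Or.inr (Or.inr ⟨r, w, by simpa [Accepts, next] using h⟩)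
    · by_cases hd : d = 0
      · left
        have : Accepts D r₀ pos cmp n toInit (fun _ => 0)
          (w.map some ++ none :: (u.map some ++ [none])) := by
          simpa [Accepts, next, hd] using h
        exact ((hI w).1 this).2
      · right; left
        have : Accepts D r₀ pos cmp n toProgram (fun _ => 0)
          (w.map some ++ none :: (u.map some ++ [none])) := by
          simpa [Accepts, next, hd] using h
        exact ((hP w).1 this).2
  · rintro (h | h | ⟨r, w, h⟩)
    -- Any zero test selects the check of the first block; below, any other instruction selects the
    -- check of the program.
    · refine ⟨[.inr (r₀, 0)], ?_⟩
      have := (hI []).2 ⟨rfl, h⟩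
      simpa [Accepts, next] using this
    · refine ⟨[.inr (r₀, 1)], ?_⟩
      have := (hP []).2 ⟨rfl, h⟩
      simpa [Accepts, next] using this
    · exact ⟨.inl r :: w, by simpa [Accepts, next] using h⟩

/-! ### Markers, phases and determinism -/

/-- The number of markers to be read until acceptance. -/
def markersLeft : CheckState ρ σ → ℕ
  | start => 2
  | toInit => 2
  | toProgram => 2
  | load _ => 2
  | accepting => 0
  | _ => 1

theorem markersLeft_of_mem_next {q : CheckState ρ σ} {x : Option (Letter ρ)} {t : Fin k → Bool}
    {m : CheckState ρ σ × (Fin k → SignType)} (h : m ∈ next D r₀ pos cmp n q x t) :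
    markersLeft q = markersLeft m.1 + if x = none then 1 else 0 := by
  have henter : ∀ r, m ∈ enter pos r t → markersLeft m.1 = 1 := by
    intro r h
    rcases pos with _ | p
    · simp only [enter, List.mem_cons, List.not_mem_nil, or_false] at h
      rcases h with rfl | rfl <;> rfl
    · simp only [enter] at h
      split at h <;> obtain rfl := List.mem_singleton.1 h <;> rfl
  rcases q with _ | _ | _ | _ | _ | q | r | r | r | r | _ | j <;> rcases x with _ | a | ⟨i, d⟩ <;>
    simp only [next] at h <;> (try split_ifs at h) <;>
    first
    | exact (List.not_mem_nil h).elim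
    | (rw [henter _ h]; simp [markersLeft])
    | (obtain rfl := List.mem_singleton.1 h; simp [markersLeft])

theorem countP_isNone_of_accepts {q : CheckState ρ σ} {c : Fin k → ℕ} {z : List (Option (Letter ρ))}
    (h : Accepts D r₀ pos cmp n q c z) : z.countP Option.isNone = markersLeft q := by
  induction z generalizing q c with
  | nil =>
    obtain rfl : q = accepting := h
    simp [markersLeft]
  | cons x z ih =>
    obtain ⟨m, hm, h⟩ := h
    rw [List.countP_cons, ih h, markersLeft_of_mem_next hm]
    simp

theorem not_accepts_start_none (c : Fin k → ℕ) (z : List (Option (Letter ρ))) :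
    ¬ Accepts D r₀ pos cmp n start c (none :: z) := by
  simp [Accepts, next]

/-- The phases of a computation. -/
def phase : CheckState ρ σ → ℕ
  | start => 0
  | load _ => 0
  | seek _ => 1
  | before _ => 2
  | after _ => 3
  | _ => 4

/-- The direction in which a counter may change in a phase. -/
def direction (pos : Option (Fin k)) (cmp i : Fin k) : ℕ → SignType
  | 0 => if pos = some i then 1 else 0
  | 1 => if pos = some i then -1 else 0
  | 2 => if cmp = i then 1 else 0
  | 3 => if cmp = i then -1 else 0
  | _ => 0

/-- A move between phases has its counter change assigned to some phase `l` in between: the move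
from `before` to `after` increments in phase 2 or decrements in phase 3. -/
theorem phase_of_mem_next {q : CheckState ρ σ} {x : Option (Letter ρ)} {t : Fin k → Bool}
    {m : CheckState ρ σ × (Fin k → SignType)} (h : m ∈ next D r₀ pos cmp n q x t) :
    ∃ l, phase q ≤ l ∧ l ≤ phase m.1 ∧ ∀ i, m.2 i = 0 ∨ m.2 i = direction pos cmp i l := by
  have hchange : ∀ (o : Option (Fin k)) d i, change o d i = if o = some i then d else 0 :=
    fun _ _ _ => rfl
  have henter : ∀ r, m ∈ enter pos r t →
      (phase m.1 = 1 ∨ phase m.1 = 2) ∧ ∀ i, m.2 i = 0 ∨ m.2 i = direction pos cmp i 1 := by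
    intro r h
    rcases pos with _ | p
    · simp only [enter, List.mem_cons, List.not_mem_nil, or_false] at h
      rcases h with rfl | rfl <;> simp [phase]
    · simp only [enter] at h
      split at h <;> obtain rfl := List.mem_singleton.1 h <;>
        simp [phase, direction, hchange]
  have henter' : ∀ r, m ∈ enter pos r t → phase q ≤ 1 →
      ∃ l, phase q ≤ l ∧ l ≤ phase m.1 ∧ ∀ i, m.2 i = 0 ∨ m.2 i = direction pos cmp i l := by
    intro r h hq
    obtain ⟨h1, h2⟩ := henter r h
    exact ⟨1, hq, by omega, h2⟩
  rcases q with _ | _ | _ | _ | _ | q | r | r | r | r | _ | j <;> rcases x with _ | a | ⟨i, d⟩ <;>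
    simp only [next] at h <;> (try split_ifs at h) <;>
    first
    | exact (List.not_mem_nil h).elim
    | (refine henter' _ h ?_; simp [phase])
    | (obtain rfl := List.mem_singleton.1 h
       first
       | (refine ⟨4, ?_, ?_, ?_⟩ <;> simp [phase]; done)
       | (refine ⟨0, ?_, ?_, ?_⟩ <;> simp [phase, direction, hchange]; done)
       | (refine ⟨1, ?_, ?_, ?_⟩ <;> simp [phase, direction, hchange]; done)
       | (refine ⟨2, ?_, ?_, ?_⟩ <;> simp [phase, direction, hchange]; done)
       | (refine ⟨3, ?_, ?_, ?_⟩ <;> simp [phase, direction, hchange]))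

theorem nonneg_of_mem_next {q : CheckState ρ σ} {x : Option (Letter ρ)} {t : Fin k → Bool}
    {m : CheckState ρ σ × (Fin k → SignType)} (h : m ∈ next D r₀ pos cmp n q x t) (i : Fin k)
    (hi : t i = false) : 0 ≤ m.2 i := by
  have hchange : ∀ (o : Option (Fin k)) d i, (o = some i → 0 ≤ d) → 0 ≤ change o d i := by
    intro o d i h
    unfold change
    split_ifs with ho
    exacts [h ho, le_rfl]
  have henter : ∀ r, m ∈ enter pos r t → 0 ≤ m.2 i := by
    intro r h
    rcases pos with _ | p
    · simp only [enter, List.mem_cons, List.not_mem_nil, or_false] at h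
      rcases h with rfl | rfl <;> simp
    · simp only [enter] at h
      split at h <;> obtain rfl := List.mem_singleton.1 h
      · refine hchange _ _ _ fun hp => ?_
        obtain rfl := Option.some_injective _ hp
        simp_all
      · simp
  rcases q with _ | _ | _ | _ | _ | q | r | r | r | r | _ | j <;> rcases x with _ | a | ⟨b, d⟩ <;>
    simp only [next] at h <;> (try split_ifs at h) <;>
    first
    | exact (List.not_mem_nil h).elim
    | exact henter _ h
    | (obtain rfl := List.mem_singleton.1 h
       first
       | exact le_rfl
       | (refine hchange _ _ _ fun _ => ?_; decide)
       | (refine hchange _ _ _ fun hp => ?_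
          obtain rfl := Option.some_injective _ hp
          simp_all))

/-- The guess in `enter` is the only branching, and a position counter replaces it. -/
theorem next_subsingleton {p : Fin k} {q : CheckState ρ σ} {x : Option (Letter ρ)}
    {t : Fin k → Bool} {m m' : CheckState ρ σ × (Fin k → SignType)}
    (h : m ∈ next D r₀ (some p) cmp n q x t) (h' : m' ∈ next D r₀ (some p) cmp n q x t) :
    m = m' := by
  have key : ∀ l : List (CheckState ρ σ × (Fin k → SignType)), l.length ≤ 1 → m ∈ l → m' ∈ l →
      m = m' := by
    rintro (_ | ⟨a, _ | ⟨b, l⟩⟩) hl h h'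
    · simp at h
    · rw [List.mem_singleton.1 h, List.mem_singleton.1 h']
    · simp at hl
  refine key _ ?_ h h'
  rcases q with _ | _ | _ | _ | _ | q | r | r | r | r | _ | j <;> rcases x with _ | a | ⟨b, d⟩ <;>
    simp only [next, enter] <;> (try split_ifs) <;> simp

end CheckState

/-! ### Counting reversals by phases -/

/-- Every nonzero change carries a phase that determines its sign, and phases never decrease.
Neighbours that survive the merging have different signs, hence strictly increasing phases, so at
most `A.card` changes survive. -/
theorem CounterMachine.reversals_le {b : ℕ} {ds : List SignType} {f : ℕ → SignType}
    (A : Finset ℕ) (hA : A.card ≤ b + 1) (ps : List ℕ) (hps : ps.Pairwise (· ≤ ·))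
    (hpA : ∀ p ∈ ps, p ∈ A) (h : ds.filter (· ≠ 0) = ps.map f) :
    reversals ds ≤ b := by
  have hsub : ((ds.filter (· ≠ 0)).destutter (· ≠ ·)).Sublist (ps.map f) := by
    rw [← h]
    exact List.destutter_sublist _ _
  obtain ⟨qs, hqs, hq⟩ := List.sublist_map_iff.1 hsub
  have hchain : (qs.map f).IsChain (· ≠ ·) := by
    rw [← hq]
    exact List.isChain_destutter _ _
  have hlt : qs.IsChain (· < ·) := by
    rw [List.isChain_map] at hchain
    have hle : qs.IsChain (· ≤ ·) := (hps.sublist hqs).isChain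
    rw [List.isChain_iff_getElem] at hchain hle ⊢
    intro i hi
    refine lt_of_le_of_ne (hle i hi) fun heq => hchain i hi ?_
    rw [heq]
  have hnodup : qs.Nodup := by
    rw [List.isChain_iff_pairwise] at hlt
    exact hlt.imp ne_of_lt
  have hcard : qs.length ≤ A.card := by
    rw [← List.toFinset_card_of_nodup hnodup]
    exact Finset.card_le_card fun x hx => hpA x (hqs.subset (by simpa using hx))
  unfold reversals
  rw [hq, List.length_map]
  omega

/-! ### Numbered states and the counter machine -/

namespace CheckState

variable {k a : ℕ} {ρ σ : Type} [Fintype ρ] [Fintype σ]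

/-- The states are the elements of a finite type and those that read the initial contents. -/
def toSum : CheckState ρ σ → (Fin 5 ⊕ σ ⊕ Fin 4 × ρ) ⊕ ℕ
  | start => .inl (.inl 0)
  | accepting => .inl (.inl 1)
  | found => .inl (.inl 2)
  | toInit => .inl (.inl 3)
  | toProgram => .inl (.inl 4)
  | program q => .inl (.inr (.inl q))
  | load r => .inl (.inr (.inr (0, r)))
  | seek r => .inl (.inr (.inr (1, r)))
  | before r => .inl (.inr (.inr (2, r)))
  | after r => .inl (.inr (.inr (3, r)))
  | init j => .inr j

theorem toSum_injective {ρ σ : Type} :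
    Function.Injective (toSum : CheckState ρ σ → (Fin 5 ⊕ σ ⊕ Fin 4 × ρ) ⊕ ℕ) := by
  intro p q h
  cases p <;> cases q <;> simp_all [toSum]

theorem toSum_surjective {ρ σ : Type} :
    Function.Surjective (toSum : CheckState ρ σ → (Fin 5 ⊕ σ ⊕ Fin 4 × ρ) ⊕ ℕ) := by
  rintro ((x | q | ⟨x, r⟩) | j)
  · fin_cases x
    exacts [⟨start, rfl⟩, ⟨accepting, rfl⟩, ⟨found, rfl⟩, ⟨toInit, rfl⟩, ⟨toProgram, rfl⟩]
  · exact ⟨program q, rfl⟩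
  · fin_cases x
    exacts [⟨load r, rfl⟩, ⟨seek r, rfl⟩, ⟨before r, rfl⟩, ⟨after r, rfl⟩]
  · exact ⟨init j, rfl⟩

/-- The number of states that do not read the initial contents. -/
def numFixed (ρ σ : Type) [Fintype ρ] [Fintype σ] : ℕ := Fintype.card (Fin 5 ⊕ σ ⊕ Fin 4 × ρ)

/-- The numbers of the states. -/
noncomputable def index (q : CheckState ρ σ) : ℕ :=
  Sum.elim (fun x => (Fintype.equivFin (Fin 5 ⊕ σ ⊕ Fin 4 × ρ) x : ℕ))
    (fun j => numFixed ρ σ + j) q.toSum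

theorem index_injective : Function.Injective (index : CheckState ρ σ → ℕ) := by
  intro p q h
  apply toSum_injective
  unfold index at h
  rcases hp : p.toSum with x | j <;> rcases hq : q.toSum with y | l <;>
    simp only [hp, hq, Sum.elim_inl, Sum.elim_inr] at h
  · rw [(Fintype.equivFin _).injective (Fin.ext h)]
  · have := (Fintype.equivFin (Fin 5 ⊕ σ ⊕ Fin 4 × ρ) x).2
    unfold numFixed at h
    omega
  · have := (Fintype.equivFin (Fin 5 ⊕ σ ⊕ Fin 4 × ρ) y).2
    unfold numFixed at h
    omega
  · rw [Nat.add_left_cancel h]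

theorem index_init (j : ℕ) : index (init j : CheckState ρ σ) = numFixed ρ σ + j := rfl

theorem index_lt_of_forall_ne {q : CheckState ρ σ} (hq : ∀ j, q ≠ init j) (n : ℕ) :
    index q < numFixed ρ σ + n + 1 := by
  unfold index
  rcases h : q.toSum with x | j
  · have := (Fintype.equivFin (Fin 5 ⊕ σ ⊕ Fin 4 × ρ) x).2
    simp only [Sum.elim_inl, numFixed]
    omega
  · exact absurd (toSum_injective (h.trans rfl)) (hq j)

/-- The states that do not read the initial contents. -/
noncomputable def fixedStates (ρ σ : Type) [Fintype ρ] [Fintype σ] : List (CheckState ρ σ) :=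
  (Finset.univ : Finset (Fin 5 ⊕ σ ⊕ Fin 4 × ρ)).toList.map
    fun x => Function.surjInv toSum_surjective (.inl x)

theorem mem_fixedStates {q : CheckState ρ σ} : q ∈ fixedStates ρ σ ↔ ∀ j, q ≠ init j := by
  simp only [fixedStates, List.mem_map, Finset.mem_toList, Finset.mem_univ, true_and]
  constructor
  · rintro ⟨x, rfl⟩ j h
    have := Function.surjInv_eq toSum_surjective (.inl x : (Fin 5 ⊕ σ ⊕ Fin 4 × ρ) ⊕ ℕ)
    rw [h] at this
    simp [toSum] at this
  · intro h
    rcases hq : q.toSum with x | j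
    · exact ⟨x, toSum_injective ((Function.surjInv_eq toSum_surjective _).trans hq.symm)⟩
    · exact absurd (toSum_injective (hq.trans rfl)) (h j)

variable [DecidableEq ρ] (D : DFA (Instruction ρ) σ) (r₀ : ρ) (pos : Option (Fin k)) (cmp : Fin k)
  (n : ℕ) (e : Fin a ≃ Letter ρ)

/-- The transitions from one state. -/
noncomputable def transitionsFrom (q : CheckState ρ σ) :
    List (Transition k (WithMarker (Fin a))) :=
  (Finset.univ : Finset (Option (Fin a) × (Fin k → Bool))).toList.flatMap fun y =>
    (next D r₀ pos cmp n q (y.1.map e) y.2).map fun m =>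
      ((index q, some y.1, y.2), (index m.1, true, m.2))

/-- All transitions. -/
noncomputable def transitions : List (Transition k (WithMarker (Fin a))) :=
  (fixedStates ρ σ ++ [init 0]).flatMap (transitionsFrom D r₀ pos cmp n e) ++
    (List.range n).flatMap fun j => transitionsFrom D r₀ pos cmp n e (init (j + 1))

variable {D r₀ pos cmp n e}

theorem mem_transitions {τ : Transition k (WithMarker (Fin a))} :
    τ ∈ transitions D r₀ pos cmp n e ↔ ∃ q x t, index q < numFixed ρ σ + n + 1 ∧
      ∃ m ∈ next D r₀ pos cmp n q (Option.map e x) t,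
        τ = ((index q, some x, t), (index m.1, true, m.2)) := by
  have key : τ ∈ transitions D r₀ pos cmp n e ↔ ∃ q, index q < numFixed ρ σ + n + 1 ∧
      τ ∈ transitionsFrom D r₀ pos cmp n e q := by
    simp only [transitions, List.mem_append, List.mem_flatMap, mem_fixedStates,
      List.mem_singleton, List.mem_range]
    constructor
    · rintro (⟨q, hq | rfl, h⟩ | ⟨j, hj, h⟩)
      · exact ⟨q, index_lt_of_forall_ne hq n, h⟩
      · exact ⟨_, by rw [index_init]; omega, h⟩
      · exact ⟨_, by rw [index_init]; omega, h⟩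
    · rintro ⟨q, hq, h⟩
      by_cases hi : ∀ j, q ≠ init j
      · exact Or.inl ⟨q, Or.inl hi, h⟩
      · simp only [not_forall, not_not] at hi
        obtain ⟨_ | j, rfl⟩ := hi
        · exact Or.inl ⟨_, Or.inr rfl, h⟩
        · rw [index_init] at hq
          exact Or.inr ⟨j, by omega, h⟩
  rw [key]
  simp only [transitionsFrom, List.mem_flatMap, Finset.mem_toList, Finset.mem_univ, true_and,
    List.mem_map, Prod.exists]
  constructor
  · rintro ⟨q, hq, x, t, p, d, hm, rfl⟩
    exact ⟨q, x, t, hq, p, d, hm, rfl⟩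
  · rintro ⟨q, x, t, hq, p, d, hm, rfl⟩
    exact ⟨q, hq, x, t, p, d, hm, rfl⟩

theorem index_lt_of_mem_next {q : CheckState ρ σ} {x : Option (Letter ρ)} {t : Fin k → Bool}
    {m : CheckState ρ σ × (Fin k → SignType)} (hq : index q < numFixed ρ σ + n + 1)
    (h : m ∈ next D r₀ pos cmp n q x t) : index m.1 < numFixed ρ σ + n + 1 := by
  by_cases hm : ∀ j, m.1 ≠ init j
  · exact index_lt_of_forall_ne hm n
  simp only [not_forall, not_not] at hm
  obtain ⟨l, hl⟩ := hm
  have henter : ∀ r, m ∉ enter pos r t := by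
    intro r h
    rcases pos with _ | p
    · simp only [enter, List.mem_cons, List.not_mem_nil, or_false] at h
      rcases h with rfl | rfl <;> cases hl
    · simp only [enter] at h
      split at h <;> obtain rfl := List.mem_singleton.1 h <;> cases hl
  rcases q with _ | _ | _ | _ | _ | q | r | r | r | r | _ | j <;> rcases x with _ | b | ⟨i, d⟩ <;>
    simp only [next] at h <;> (try split_ifs at h) <;>
    first
    | exact (List.not_mem_nil h).elim
    | exact (henter _ h).elim
    | (obtain rfl := List.mem_singleton.1 h; cases hl; done)
    | (obtain rfl := List.mem_singleton.1 h; simp only [index_init] at hq ⊢; omega)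

variable (D r₀ pos cmp n e)

/-- The counter machine that accepts the words `w $ u $` such that `u` has the error which is
described by `w`. -/
noncomputable def machine : CounterMachine k (WithMarker (Fin a)) where
  numStates := numFixed ρ σ + n + 1
  start := index (start : CheckState ρ σ)
  accept := [index (accepting : CheckState ρ σ)]
  trans := transitions D r₀ pos cmp n e
  start_lt := index_lt_of_forall_ne (by simp) n
  accept_lt q hq := by
    rw [List.mem_singleton.1 hq]
    exact index_lt_of_forall_ne (by simp) n
  trans_lt τ hτ := by
    obtain ⟨q, x, t, hq, m, hm, rfl⟩ := mem_transitions.1 hτ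
    exact ⟨hq, index_lt_of_mem_next hq hm⟩
  trans_nonneg τ hτ i hi := by
    obtain ⟨q, x, t, hq, m, hm, rfl⟩ := mem_transitions.1 hτ
    exact nonneg_of_mem_next hm i hi

variable {D r₀ pos cmp n e}

/-! ### Runs, languages and reversal bounds of the machine -/

open CounterMachine

/-- All moves go right and none reads the end-marker, so a run follows the recursion of `Accepts`
letter by letter. The truncation by `toNat` is harmless because a zero counter is never decremented.
-/
theorem step_iff {q : CheckState ρ σ} (hq : index q < numFixed ρ σ + n + 1)
    {u : List (WithEnd (WithMarker (Fin a)))} {c : Fin k → ℕ} {d : Fin k → SignType}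
    {C : Config k (WithMarker (Fin a))} :
    (machine D r₀ pos cmp n e).Step ⟨index q, u, c⟩ d C ↔
      ∃ x v p, u = some x :: v ∧
        (p, d) ∈ next D r₀ pos cmp n q (Option.map e x) (fun i => decide (0 < c i)) ∧
        C = ⟨index p, v, fun i => ((c i : ℤ) + (d i : ℤ)).toNat⟩ := by
  constructor
  · rintro ⟨y, v, right, hu, hτ, hin, hc⟩
    obtain ⟨q', x, t, -, ⟨p, d'⟩, hm, h⟩ := mem_transitions.1 hτ
    simp only [Prod.mk.injEq] at h
    obtain ⟨⟨hq', rfl, rfl⟩, hp, rfl, rfl⟩ := h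
    obtain rfl := index_injective hq'
    refine ⟨x, v, p, hu, hm, ?_⟩
    obtain ⟨s, z, c'⟩ := C
    simp only [if_true] at hp hin hc
    subst hp
    subst hin
    congr 1
    funext i
    have := hc i
    omega
  · rintro ⟨x, v, p, rfl, hm, rfl⟩
    refine ⟨some x, v, true, rfl, mem_transitions.2 ⟨q, x, _, hq, (p, d), hm, rfl⟩, by simp,
      fun i => ?_⟩
    have h0 := nonneg_of_mem_next hm i
    refine Int.toNat_of_nonneg ?_
    by_cases hi : 0 < c i
    · cases d i <;> simp <;> omega
    · have h1 : 0 ≤ d i := h0 (by simpa using hi)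
      generalize d i = s at h1 ⊢
      cases s
      · simp
      · exact absurd h1 (by decide)
      · simp; omega

theorem exists_run_iff {q : CheckState ρ σ} (hq : index q < numFixed ρ σ + n + 1)
    (c : Fin k → ℕ) (u : List (WithMarker (Fin a))) :
    (∃ ds C, (machine D r₀ pos cmp n e).Run ⟨index q, u.map some ++ [endMarker], c⟩ ds C ∧
      C.state = index (accepting : CheckState ρ σ) ∧ C.input = [endMarker]) ↔
      Accepts D r₀ pos cmp n q c (u.map (Option.map e)) := by
  induction u generalizing q c with
  | nil =>
    constructor
    · rintro ⟨ds, C, h, hs, -⟩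
      cases h with
      | nil => exact index_injective hs
      | cons h _ =>
        obtain ⟨x, v, p, hu, -⟩ := (step_iff hq).1 h
        simp at hu
    · intro h
      obtain rfl : q = accepting := h
      exact ⟨[], _, .nil _, rfl, rfl⟩
  | cons x u ih =>
    constructor
    · rintro ⟨ds, C, h, hs, hin⟩
      cases h with
      | nil => simp at hin
      | cons h h' =>
        obtain ⟨y, v, p, hu, hm, rfl⟩ := (step_iff hq).1 h
        simp only [List.map_cons, List.cons_append, List.cons.injEq, Option.some.injEq] at hu
        obtain ⟨rfl, rfl⟩ := hu
        exact ⟨_, hm, (ih (index_lt_of_mem_next hq hm) _).1 ⟨_, C, h', hs, hin⟩⟩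
    · rintro ⟨⟨p, d⟩, hm, h⟩
      obtain ⟨ds, C, h, hs, hin⟩ := (ih (index_lt_of_mem_next hq hm) _).2 h
      exact ⟨d :: ds, C, .cons ((step_iff hq).2 ⟨x, _, p, rfl, hm, rfl⟩) h, hs, hin⟩

theorem mem_language_machine (u : List (WithMarker (Fin a))) :
    u ∈ (machine D r₀ pos cmp n e).language ↔
      Accepts D r₀ pos cmp n start (fun _ => 0) (u.map (Option.map e)) := by
  rw [← exists_run_iff (index_lt_of_forall_ne (by simp) n)]
  constructor
  · rintro ⟨ds, C, h, hs, hin⟩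
    exact ⟨ds, C, h, List.mem_singleton.1 hs, hin⟩
  · rintro ⟨ds, C, h, hs, hin⟩
    exact ⟨ds, C, h, List.mem_singleton.2 hs, hin⟩

theorem exists_phases_of_run {q : CheckState ρ σ} (hq : index q < numFixed ρ σ + n + 1)
    {u : List (WithEnd (WithMarker (Fin a)))} {c : Fin k → ℕ} {ds : List (Fin k → SignType)}
    {C : Config k (WithMarker (Fin a))}
    (h : (machine D r₀ pos cmp n e).Run ⟨index q, u, c⟩ ds C) (i : Fin k) :
    ∃ ps : List ℕ, ps.Pairwise (· ≤ ·) ∧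
      (∀ p ∈ ps, phase q ≤ p ∧ direction pos cmp i p ≠ 0) ∧
      (ds.map (· i)).filter (· ≠ 0) = ps.map (direction pos cmp i) := by
  induction ds generalizing q u c with
  | nil => exact ⟨[], by simp⟩
  | cons d ds ih =>
    cases h with
    | cons h h' =>
      obtain ⟨x, v, p, rfl, hm, rfl⟩ := (step_iff hq).1 h
      obtain ⟨ps, hps, hp, hds⟩ := ih (index_lt_of_mem_next hq hm) h'
      obtain ⟨l, hl, hl', hd⟩ := phase_of_mem_next hm
      by_cases h0 : d i = 0
      · refine ⟨ps, hps, fun y hy => ⟨(hl.trans hl').trans (hp y hy).1, (hp y hy).2⟩, ?_⟩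
        rw [← hds]
        simp [h0]
      · have hdi : d i = direction pos cmp i l := (hd i).resolve_left h0
        refine ⟨l :: ps, List.pairwise_cons.2 ⟨fun y hy => hl'.trans (hp y hy).1, hps⟩, ?_, ?_⟩
        · intro y hy
          rcases List.mem_cons.1 hy with rfl | hy
          · exact ⟨hl, hdi ▸ h0⟩
          · exact ⟨(hl.trans hl').trans (hp y hy).1, (hp y hy).2⟩
        · rw [List.map_cons, List.map_cons, ← hds, ← hdi]
          simp [h0]

theorem reversalBounded_machine {b : ℕ} (A : Fin k → Finset ℕ) (hA : ∀ i, (A i).card ≤ b + 1)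
    (h : ∀ i p, direction pos cmp i p ≠ 0 → p ∈ A i) :
    (machine D r₀ pos cmp n e).ReversalBounded b := by
  rintro w ds ⟨C, hrun, -⟩ i
  obtain ⟨ps, hps, hp, hds⟩ := exists_phases_of_run (q := start)
    (index_lt_of_forall_ne (by simp) n) hrun i
  exact reversals_le (A i) (hA i) ps hps (fun p hp' => h i p (hp p hp').2) hds

theorem machine_mem_NCM_one_one {cmp : Fin 1} :
    machine D r₀ none cmp n e ∈ NCM 1 1 (WithMarker (Fin a)) := by
  refine reversalBounded_machine (fun _ => {2, 3}) (fun _ => by decide) fun i p hp => ?_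
  rcases p with _ | _ | _ | _ | p <;> simp_all [direction]

theorem deterministic_machine {p : Fin k} :
    (machine D r₀ (some p) cmp n e).Deterministic := by
  intro τ hτ τ' hτ' h
  obtain ⟨q, x, t, -, m, hm, rfl⟩ := mem_transitions.1 hτ
  obtain ⟨q', x', t', -, m', hm', rfl⟩ := mem_transitions.1 hτ'
  simp only [Prod.mk.injEq, Option.some.injEq] at h
  obtain ⟨hq, rfl, rfl⟩ := h
  obtain rfl := index_injective hq
  rw [next_subsingleton hm hm']

theorem machine_mem_DCM_two_one :
    machine D r₀ (some (0 : Fin 2)) 1 n e ∈ DCM 2 1 (WithMarker (Fin a)) := by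
  -- Counter 0 stores the position in phases 0 and 1, counter 1 compares in phases 2 and 3.
  refine ⟨deterministic_machine, reversalBounded_machine ![{0, 1}, {2, 3}] ?_ ?_⟩
  · decide
  · intro i p hp
    fin_cases i <;> rcases p with _ | _ | _ | _ | p <;> simp_all [direction]

theorem machine_mem_DCM_one_three :
    machine D r₀ (some (0 : Fin 1)) 0 n e ∈ DCM 1 3 (WithMarker (Fin a)) := by
  -- The single counter rises and falls twice: four phases, three reversals.
  refine ⟨deterministic_machine, reversalBounded_machine (fun _ => {0, 1, 2, 3}) ?_ ?_⟩
  · decide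
  · intro i p hp
    rcases p with _ | _ | _ | _ | p <;> simp_all [direction]

end CheckState

/-! ### Density and computability of the reduction -/

namespace CheckState

open History

variable {k a : ℕ} {ρ σ : Type} [Fintype ρ] [Fintype σ] [DecidableEq ρ]
  (D : DFA (Instruction ρ) σ) (r₀ : ρ) (pos : Option (Fin k)) (cmp : Fin k) (n : ℕ)
  (e : Fin a ≃ Letter ρ)

theorem exists_eq_map_some {α : Type} (w : List (Option α)) (h : none ∉ w) :
    ∃ v : List α, w = v.map some := by
  induction w with
  | nil => exact ⟨[], rfl⟩
  | cons x w ih =>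
    rcases x with _ | x
    · simp at h
    · obtain ⟨v, rfl⟩ := ih fun hw => h (List.mem_cons_of_mem _ hw)
      exact ⟨x :: v, rfl⟩

/-- No accepted word begins with a marker, so nothing of `$ u $` stands before the deleted factor;
accepted words have exactly two markers, so the deleted factor has none. -/
theorem mem_outf_language_iff (u : List (Fin a)) :
    [marker] ++ u.map some ++ [marker] ∈ outf (machine D r₀ pos cmp n e).language ↔
      ∃ w : List (Letter ρ), Accepts D r₀ pos cmp n start (fun _ => 0)
        (w.map some ++ none :: ((u.map e).map some ++ [none])) := by
  have hmap : ∀ w : List (Fin a), (w.map some ++ ([marker] ++ u.map some ++ [marker])).map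
      (Option.map e) = (w.map e).map some ++ none :: ((u.map e).map some ++ [none]) := by
    intro w
    simp
  constructor
  · rintro ⟨x, w, y, hL, h⟩
    rw [mem_language_machine] at hL
    rcases x with _ | ⟨b, x⟩
    · rw [List.nil_append] at h hL
      subst h
      have hcount := countP_isNone_of_accepts hL
      obtain ⟨v, rfl⟩ : ∃ v : List (Fin a), w = v.map some := by
        apply exists_eq_map_some
        intro hw
        have : 0 < w.countP (Option.isNone ∘ Option.map e) :=
          List.countP_pos_iff.2 ⟨none, hw, rfl⟩
        simp [markersLeft] at hcount
        omega
      rw [hmap] at hL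
      exact ⟨_, hL⟩
    · obtain rfl : none = b := by
        simp only [List.cons_append, List.nil_append, List.cons.injEq] at h
        exact h.1
      exact (not_accepts_start_none _ _ hL).elim
  · rintro ⟨w, h⟩
    refine ⟨[], (w.map e.symm).map some, [marker] ++ u.map some ++ [marker], ?_, rfl⟩
    rw [List.nil_append, mem_language_machine, hmap]
    simpa using h

theorem markedDense_outf_iff :
    MarkedDense outf (machine D r₀ pos cmp n e).language ↔
      ¬ ∃ w ∈ D.accepts, ∃ s', Instruction.Exec w (fun r => if r = r₀ then n else 0) s' := by
  rw [← exists_right_iff]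
  unfold MarkedDense
  simp only [mem_outf_language_iff, exists_accepts_start]
  constructor
  · rintro h ⟨v, h1, h2, h3⟩
    have := h (v.map e.symm)
    rw [List.map_map, e.self_comp_symm, List.map_id] at this
    rcases this with h | h | ⟨r, h | h⟩
    exacts [h1 h, h h2, (h3 r).1 h, (h3 r).2 h]
  · intro h u
    by_contra! hu
    exact h ⟨_, hu.1, hu.2.1, hu.2.2⟩

/-- The list `l` does not depend on the input, so it may come from a noncomputable enumeration. -/
theorem primrec_flatMap_const {α β γ : Type} [Primcodable α] [Primcodable γ] (l : List β)
    (F : β → α → List γ) (hF : ∀ b, Primrec (F b)) :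
    Primrec fun x => l.flatMap fun b => F b x := by
  induction l with
  | nil => exact Primrec.const _
  | cons b l ih =>
    simp only [List.flatMap_cons]
    exact Primrec.list_append.comp (hF b) ih

/-- For a fixed state, `n` occurs only in the target of the move of `toInit` on the marker;
everything else is constant. -/
theorem primrec_transitionsFrom (q : CheckState ρ σ) :
    Primrec fun n => transitionsFrom D r₀ pos cmp n e q := by
  refine primrec_flatMap_const _ _ fun y => ?_
  obtain ⟨x, t⟩ := y
  simp only
  generalize Option.map e x = z
  rcases q with _ | _ | _ | _ | _ | q | r | r | r | r | _ | j <;> rcases z with _ | b | ⟨i, d⟩ <;>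
    simp only [next] <;>
    first
    | exact Primrec.const _
    | (simp only [List.map_cons, List.map_nil, index_init]
       exact Primrec.list_cons.comp (Primrec.pair (Primrec.const _)
        (Primrec.pair (Primrec.nat_add.comp (Primrec.const _) Primrec.id) (Primrec.const _)))
        (Primrec.const _))

theorem primrec_transitionsFrom_init :
    Primrec fun j => transitionsFrom D r₀ pos cmp 0 e (init (j + 1)) := by
  refine primrec_flatMap_const _ _ fun y => ?_
  obtain ⟨x, t⟩ := y
  simp only
  generalize Option.map e x = z
  have hadd : ∀ m, Primrec fun j : ℕ => numFixed ρ σ + (j + m) := fun m =>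
    Primrec.nat_add.comp (Primrec.const _) (Primrec.nat_add.comp Primrec.id (Primrec.const m))
  have hp : ∀ (y : Option (WithMarker (Fin a))) (s : Bool × (Fin k → SignType)) (p : ℕ → ℕ),
      Primrec p → Primrec fun j => [((numFixed ρ σ + (j + 1), y, t), (p j, s))] :=
    fun y s p hp => Primrec.list_cons.comp
      (Primrec.pair (Primrec.pair (hadd 1) (Primrec.const _)) (Primrec.pair hp (Primrec.const _)))
      (Primrec.const _)
  rcases z with _ | b | i <;> simp only [next] <;> (try split_ifs) <;>
    simp only [List.map_cons, List.map_nil, index_init] <;>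
    first
    | exact hp _ _ _ (Primrec.const _)
    | exact hp _ _ _ (hadd 0)

/-- These states do not refer to `n`, which leaves `j` as the only variable in their transitions. -/
theorem transitionsFrom_init_succ (j : ℕ) :
    transitionsFrom D r₀ pos cmp n e (init (j + 1)) =
      transitionsFrom D r₀ pos cmp 0 e (init (j + 1)) := by
  unfold transitionsFrom
  congr 1
  funext y
  congr 1
  generalize Option.map e y.1 = z
  rcases z with _ | b | i <;> rfl

theorem primrec_code_machine : Primrec fun n => (machine D r₀ pos cmp n e).code := by
  refine Primrec.pair ?_ (Primrec.pair (Primrec.const _) (Primrec.pair (Primrec.const _) ?_))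
  · exact Primrec.succ.comp (Primrec.nat_add.comp (Primrec.const _) Primrec.id)
  · refine Primrec.list_append.comp
      (primrec_flatMap_const _ _ fun q => primrec_transitionsFrom D r₀ pos cmp e q) ?_
    simp only [transitionsFrom_init_succ]
    exact Primrec.list_flatMap Primrec.list_range
      ((primrec_transitionsFrom_init D r₀ pos cmp e).comp Primrec.snd)

end CheckState

/-! ### Undecidability -/

/-- The algorithm may diverge outside the class, but along a family inside it the composition is
total. -/
theorem computablePred_of_decidableFor {k a : ℕ} {C : Set (CounterMachine k (WithMarker (Fin a)))}
    {P : CounterMachine k (WithMarker (Fin a)) → Prop} (h : DecidableFor C P)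
    {M : ℕ → CounterMachine k (WithMarker (Fin a))} (hM : Computable fun n => (M n).code)
    (hC : ∀ n, M n ∈ C) : ComputablePred fun n => P (M n) := by
  obtain ⟨f, hf, h⟩ := h
  choose b hb hP using fun n => h (M n) (hC n)
  refine ComputablePred.computable_iff.2 ⟨b, ?_, funext fun n => propext (hP n).symm⟩
  exact (hf.comp hM).of_eq fun n => Part.eq_some_iff.2 (hb n)

theorem proposition5 :
    ∃ n : ℕ,
      ¬ DecidableFor (NCM 1 1 (WithMarker (Fin n))) (fun M => MarkedDense outf M.language) ∧
      ¬ DecidableFor (DCM 2 1 (WithMarker (Fin n))) (fun M => MarkedDense outf M.language) ∧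
      ¬ DecidableFor (DCM 1 3 (WithMarker (Fin n))) (fun M => MarkedDense outf M.language) := by
  -- A single universal function, running program `n` on input 0, fixes the automaton, the registers
  -- and hence the alphabet for all instances.
  let f : ℕ →. ℕ := fun n => Nat.Partrec.Code.eval (Denumerable.ofNat Nat.Partrec.Code n) 0
  have hf : Partrec f :=
    Nat.Partrec.Code.eval_part.comp (Computable.ofNat _) (Computable.const 0)
  obtain ⟨K, σ, _, D, hD⟩ := RegisterTrace.exists_dfa_of_partrec hf
  let e := (Fintype.equivFin (Letter (Fin (K + 1)))).symm
  have key : ∀ {k : ℕ} {C : Set (CounterMachine k (WithMarker (Fin _)))} (pos : Option (Fin k))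
      (cmp : Fin k), (∀ n, CheckState.machine D 0 pos cmp n e ∈ C) →
      ¬ DecidableFor C (fun M => MarkedDense outf M.language) := by
    intro k C pos cmp hC h
    have h1 := computablePred_of_decidableFor h
      (CheckState.primrec_code_machine D 0 pos cmp e).to_comp hC
    have h2 : ComputablePred fun n => (f n).Dom := by
      refine h1.not.of_eq fun n => ?_
      rw [CheckState.markedDense_outf_iff, not_not, hD]
    refine ComputablePred.halting_problem 0 ?_
    obtain ⟨g, hg, hgf⟩ := ComputablePred.computable_iff.1 h2
    refine ComputablePred.computable_iff.2 ⟨_, hg.comp Computable.encode, funext fun c => ?_⟩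
    have := congrFun hgf (Encodable.encode c)
    simpa [f] using this
  exact ⟨_, key none 0 fun _ => CheckState.machine_mem_NCM_one_one,
    key (some 0) 1 fun _ => CheckState.machine_mem_DCM_two_one,
    key (some 0) 0 fun _ => CheckState.machine_mem_DCM_one_three⟩
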